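/- **Setting.** Let $d,T\ge 1$, $R\ge 0$, $L\ge 0$. Let $\rho$ be a probability distribution on $\mathbb{R}^d$ with bounded support (the environment), and for $\mathbf h\in\mathbb{R}^d$ put $\mathrm{Var}_{\mathbf h}=\mathbb{E}_{\mathbf w\sim\rho}\|\mathbf w-\mathbf h\|_2^2$ and $\overline{\mathbf w}=\mathbb{E}_{\mathbf w\sim\rho}\mathbf w$. In a task $\mathbf w$, at each round $t=1,\dots,T$ a decision set $\mathcal D_t\subseteq\mathbb{R}^d$ is given, the learner picks an arm $\mathbf x_t\in\mathcal D_t$, which is determined by the past, and observes $y_t=\mathbf x_t^\top\mathbf w+\eta_t$, where $\eta_t$ is $R$-sub-Gaussian conditionally on the past (including $\mathbf x_t$). For $\rho$-almost every $\mathbf w$, all $t$ and all $\mathbf x\in\mathcal D_t$, $\|\mathbf x\|_2\le L$ and $\mathbf x^\top\mathbf w\in[-1,1]$. The optimal policy picks $\mathbf x_t^*\in\arg\max_{\mathbf x\in\mathcal D_t}\mathbf x^\top\mathbf w$ (assumed to exist), the pseudo-regret is $R(T,\mathbf w)=\sum_{t=1}^T(\mathbf x_t^*-\mathbf x_t)^\top\mathbf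 w$, and the transfer regret is $\mathcal R(T,\rho)=\mathbb{E}_{\mathbf w\sim\rho}\big[\mathbb{E}[R(T,\mathbf w)]\big]$. BIAS-OFUL with bias $\mathbf h$ and regularization $\lambda>0$, run with confidence level $\delta=1/T$ and knowledge of $\|\mathbf h-\mathbf w\|_2$, picks at round $t$ $$\mathbf x_t\in\arg\max_{\mathbf x\in\mathcal D_t}\Big\{\mathbf x^\top\widehat{\mathbf w}^{\mathbf h}_{t-1}+\beta^{\mathbf h}_{t-1}(\delta)\sqrt{\mathbf x^\top \mathbf V_{t-1}^{-1}\mathbf x}\Big\},$$ where $\mathbf V_t=\lambda \mathbf I+\sum_{s\le t}\mathbf x_s\mathbf x_s^\top$, $\widehat{\mathbf w}^{\mathbf h}_t=\mathbf h+\mathbf V_t^{-1}\sum_{s\le t}(y_s-\mathbf x_s^\top\mathbf h)\mathbf x_s$ and $$\beta^{\mathbf h}_t(\delta)=\lambda^{1/2}\|\mathbf h-\mathbf w\|_2+R\sqrt{2\log\frac{\det(\mathbf V_t)^{1/2}}{\det(\lambda \mathbf I)^{1/2}\,\delta}}.$$ For $C,V,\Lambda\ge0$ put $$B(C,\Lambda,V)=\Bigg[1+\sqrt{Td\log\Big(T+\frac{T^3\Lambda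 V}{d}\Big)}\Bigg]\,C\sqrt{d\log\Big(1+\frac{T^2\Lambda V}{d}\Big)}.$$ **Corollary (ITL vs Oracle transfer regret).** There is a universal constant $C_0>0$ such that in every such setting the following hold. (i) *Independent Task Learning.* If $\mathrm{Var}_{\mathbf 0}>0$ and $\lambda=\frac1{T\,\mathrm{Var}_{\mathbf 0}}\ge 1$, then BIAS-OFUL with bias $\mathbf h=\mathbf 0$ and this $\lambda$ satisfies $$\mathcal R(T,\rho)\le B(C,L,\mathrm{Var}_{\mathbf 0})=\Bigg[1+\sqrt{Td\log\Big(T+\frac{T^3L\mathrm{Var}_{\mathbf 0}}{d}\Big)}\Bigg]C\sqrt{d\log\Big(1+\frac{T^2L\mathrm{Var}_{\mathbf 0}}{d}\Big)}$$ with $C=C_0\max(1,R)\max(1,L)$, and also $\mathcal R(T,\rho)\le B(C',L^2,\mathrm{Var}_{\mathbf 0})$ with $C'=C_0\max(1,R)$. (ii) *The Oracle.* If $\mathrm{Var}_{\overline{\mathbf w}}>0$ and $\lambda=\frac1{T\,\mathrm{Var}_{\overline{\mathbf w}}}\ge 1$, then BIAS-OFUL with bias $\mathbf h=\overline{\mathbf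 w}$ and this $\lambda$ satisfies $$\mathcal R(T,\rho)\le B(C,L,\mathrm{Var}_{\overline{\mathbf w}})=\Bigg[1+\sqrt{Td\log\Big(T+\frac{T^3L\mathrm{Var}_{\overline{\mathbf w}}}{d}\Big)}\Bigg]C\sqrt{d\log\Big(1+\frac{T^2L\mathrm{Var}_{\overline{\mathbf w}}}{d}\Big)}$$ with the same $C$, and also $\mathcal R(T,\rho)\le B(C',L^2,\mathrm{Var}_{\overline{\mathbf w}})$ with the same $C'$. Moreover, for fixed $C,L,T,d$ the bound vanishes with the variance: $B(C,L,V)\to 0$ as $V\downarrow 0$. -/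

import Mathlib

open MeasureTheory ProbabilityTheory Filter Topology

noncomputable section

/-- The regularised design matrix `V_t = lam I + ∑_{s < t} x_s x_sᵀ` of the first `t` arms. -/
def designMatrix {d : ℕ} (lam : ℝ) (x : ℕ → EuclideanSpace ℝ (Fin d)) (t : ℕ) :
    Matrix (Fin d) (Fin d) ℝ :=
  lam • (1 : Matrix (Fin d) (Fin d) ℝ)
    + ∑ s ∈ Finset.range t, Matrix.vecMulVec (x s).ofLp (x s).ofLp

/-- The ridge estimate with bias `h` after `t` rounds: `h + V_t⁻¹ ∑_{s < t} (y_s - x_sᵀ h) x_s`. -/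
def biasedEstimate {d : ℕ} (lam : ℝ) (h : EuclideanSpace ℝ (Fin d))
    (x : ℕ → EuclideanSpace ℝ (Fin d)) (y : ℕ → ℝ) (t : ℕ) : EuclideanSpace ℝ (Fin d) :=
  h + WithLp.toLp 2 (Matrix.mulVec (designMatrix lam x t)⁻¹
    (∑ s ∈ Finset.range t, (y s - inner ℝ (x s) h) • (x s).ofLp))

/-- The weighted norm `‖v‖_A = √(vᵀ A v)`. -/
def weightedNorm {d : ℕ} (A : Matrix (Fin d) (Fin d) ℝ) (v : EuclideanSpace ℝ (Fin d)) : ℝ :=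
  √(v.ofLp ⬝ᵥ Matrix.mulVec A v.ofLp)

/-- The radius `β_t(δ)` of the confidence ellipsoid around the estimate with bias `h`, for the
task `w` and noise level `R`. -/
def confidenceRadius {d : ℕ} (R lam δ : ℝ) (h w : EuclideanSpace ℝ (Fin d))
    (x : ℕ → EuclideanSpace ℝ (Fin d)) (t : ℕ) : ℝ :=
  √lam * ‖h - w‖ + R * √(2 * Real.log (√(designMatrix lam x t).det
    / (√(lam • (1 : Matrix (Fin d) (Fin d) ℝ)).det * δ)))

/-- The optimistic value of the arm `v` after `t` rounds:
`vᵀ ŵ_t + β_t(δ) ‖v‖_{V_t⁻¹}`. -/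
def optimisticValue {d : ℕ} (R lam δ : ℝ) (h w : EuclideanSpace ℝ (Fin d))
    (x : ℕ → EuclideanSpace ℝ (Fin d)) (y : ℕ → ℝ) (t : ℕ) (v : EuclideanSpace ℝ (Fin d)) : ℝ :=
  inner ℝ v (biasedEstimate lam h x y t)
    + confidenceRadius R lam δ h w x t * weightedNorm (designMatrix lam x t)⁻¹ v

/-- The reward `x_tᵀ w + η_t`. -/
def reward {d : ℕ} {Ω : Type*} (w : EuclideanSpace ℝ (Fin d))
    (x : ℕ → Ω → EuclideanSpace ℝ (Fin d)) (η : ℕ → Ω → ℝ) (t : ℕ) (ω : Ω) : ℝ :=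
  inner ℝ (x t ω) w + η t ω

/-- `X` is `R`-sub-Gaussian conditionally on the σ-algebra `m`. -/
def IsCondSubGaussian {Ω : Type*} (m : MeasurableSpace Ω) {mΩ : MeasurableSpace Ω}
    (P : Measure Ω) (X : Ω → ℝ) (R : ℝ) : Prop :=
  ∀ s : ℝ, Integrable (fun ω => Real.exp (s * X ω)) P ∧
    P[fun ω => Real.exp (s * X ω) | m] ≤ᵐ[P] fun _ => Real.exp (s ^ 2 * R ^ 2 / 2)

/-- A linear stochastic bandit with parameter `w` over `T` rounds (indexed `0, …, T - 1`):
`D t` is the decision set, `x t` the arm picked in it, `η t` the noise of the reward, and `ℱ t`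
what is known before the reward of round `t` is revealed. -/
structure IsLinearBandit {d : ℕ} {Ω : Type*} {mΩ : MeasurableSpace Ω} (T : ℕ) (R L : ℝ)
    (w : EuclideanSpace ℝ (Fin d)) (P : Measure Ω) (ℱ : Filtration ℕ mΩ)
    (D : ℕ → Ω → Set (EuclideanSpace ℝ (Fin d)))
    (x : ℕ → Ω → EuclideanSpace ℝ (Fin d)) (η : ℕ → Ω → ℝ) : Prop where
  arm_measurable : ∀ t < T, StronglyMeasurable[ℱ t] (x t)
  noise_measurable : ∀ t < T, StronglyMeasurable[ℱ (t + 1)] (η t)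
  noise_subGaussian : ∀ t < T, IsCondSubGaussian (ℱ t) P (η t) R
  arm_mem : ∀ t < T, ∀ᵐ ω ∂P, x t ω ∈ D t ω
  norm_le : ∀ t < T, ∀ᵐ ω ∂P, ∀ v ∈ D t ω, ‖v‖ ≤ L
  mean_mem : ∀ t < T, ∀ᵐ ω ∂P, ∀ v ∈ D t ω, inner ℝ v w ∈ Set.Icc (-1 : ℝ) 1

/-- The arms `x` are picked by BIAS-OFUL with bias `h`, regularisation `lam`, confidence level
`δ`, and knowledge of the distance of `h` to `w`: in each round the arm maximises the optimistic
value over the decision set. -/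
def IsBiasOFUL {d : ℕ} {Ω : Type*} {mΩ : MeasurableSpace Ω} (T : ℕ) (R lam δ : ℝ)
    (h w : EuclideanSpace ℝ (Fin d)) (P : Measure Ω)
    (D : ℕ → Ω → Set (EuclideanSpace ℝ (Fin d)))
    (x : ℕ → Ω → EuclideanSpace ℝ (Fin d)) (η : ℕ → Ω → ℝ) : Prop :=
  ∀ t < T, ∀ᵐ ω ∂P, IsMaxOn
    (optimisticValue R lam δ h w (fun s => x s ω) (fun s => reward w x η s ω) t)
    (D t ω) (x t ω)

/-- The arms `xs` are those of the optimal policy for the task `w`. -/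
def IsOptimalPolicy {d : ℕ} {Ω : Type*} {mΩ : MeasurableSpace Ω} (T : ℕ)
    (w : EuclideanSpace ℝ (Fin d)) (P : Measure Ω)
    (D : ℕ → Ω → Set (EuclideanSpace ℝ (Fin d)))
    (xs : ℕ → Ω → EuclideanSpace ℝ (Fin d)) : Prop :=
  ∀ t < T, ∀ᵐ ω ∂P, xs t ω ∈ D t ω ∧ IsMaxOn (fun v => inner ℝ v w) (D t ω) (xs t ω)

/-- The pseudo-regret `R(T, w) = ∑_t (x*_t - x_t)ᵀ w`. -/
def pseudoRegret {d : ℕ} {Ω : Type*} (T : ℕ) (w : EuclideanSpace ℝ (Fin d))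
    (xs x : ℕ → Ω → EuclideanSpace ℝ (Fin d)) (ω : Ω) : ℝ :=
  ∑ t ∈ Finset.range T, inner ℝ (xs t ω - x t ω) w

/-- The transfer regret `E_{w ∼ ρ} [E [R(T, w)]]`; `xs w` and `x w` are the optimal arms and the
learner's arms in the task `w`. -/
def transferRegret {d : ℕ} {Ω : Type*} [MeasurableSpace Ω] (T : ℕ)
    (ρ : Measure (EuclideanSpace ℝ (Fin d))) (P : Measure Ω)
    (xs x : EuclideanSpace ℝ (Fin d) → ℕ → Ω → EuclideanSpace ℝ (Fin d)) : ℝ :=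
  ∫ w, ∫ ω, pseudoRegret T w (xs w) (x w) ω ∂P ∂ρ

/-- `Var_h = E_{w ∼ ρ} ‖w - h‖²`. -/
def taskVar {d : ℕ} (ρ : Measure (EuclideanSpace ℝ (Fin d))) (h : EuclideanSpace ℝ (Fin d)) : ℝ :=
  ∫ w, ‖w - h‖ ^ 2 ∂ρ

/-- The mean task `E_{w ∼ ρ} w`. -/
def meanTask {d : ℕ} (ρ : Measure (EuclideanSpace ℝ (Fin d))) : EuclideanSpace ℝ (Fin d) :=
  ∫ w, w ∂ρ

/-- BIAS-OFUL with bias `h`, regularisation `lam` and confidence level `1 / T` is run on tasks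
drawn from the environment `ρ`. All data of the interaction may depend on the task `w`. -/
structure IsTransferRun {d : ℕ} {Ω : Type*} {mΩ : MeasurableSpace Ω} (T : ℕ) (R L lam : ℝ)
    (h : EuclideanSpace ℝ (Fin d)) (ρ : Measure (EuclideanSpace ℝ (Fin d))) (P : Measure Ω)
    (ℱ : EuclideanSpace ℝ (Fin d) → Filtration ℕ mΩ)
    (D : EuclideanSpace ℝ (Fin d) → ℕ → Ω → Set (EuclideanSpace ℝ (Fin d)))
    (x xs : EuclideanSpace ℝ (Fin d) → ℕ → Ω → EuclideanSpace ℝ (Fin d))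
    (η : EuclideanSpace ℝ (Fin d) → ℕ → Ω → ℝ) : Prop where
  arm_measurable : ∀ t < T, Measurable fun p : EuclideanSpace ℝ (Fin d) × Ω => x p.1 t p.2
  opt_measurable : ∀ t < T, Measurable fun p : EuclideanSpace ℝ (Fin d) × Ω => xs p.1 t p.2
  bandit : ∀ᵐ w ∂ρ, IsLinearBandit T R L w P (ℱ w) (D w) (x w) (η w)
  policy : ∀ᵐ w ∂ρ, IsBiasOFUL T R lam (1 / (T : ℝ)) h w P (D w) (x w) (η w)
  optimal : ∀ᵐ w ∂ρ, IsOptimalPolicy T w P (D w) (xs w)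

/-- `[1 + √(T d log (T + T³ L V / d))] C √(d log (1 + T² L V / d))`. -/
def transferBound (C : ℝ) (T d : ℕ) (L V : ℝ) : ℝ :=
  (1 + √((T : ℝ) * d * Real.log (T + (T : ℝ) ^ 3 * L * V / d)))
    * (C * √((d : ℝ) * Real.log (1 + (T : ℝ) ^ 2 * L * V / d)))

end

/-! ### Quadratic forms of positive definite matrices and rank-one updates. -/

section LinearAlgebra

open Matrix

variable {n : Type*} [Fintype n]

/-! Let `V` be the variance of the tasks around the bias `h`. With `lam = 1 / (T * V)` the term
`√lam * ‖h - w‖` of the confidence radius averages to at most `1 / √T`. Nothing else depends on the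
bias, so both claims are instances of `IsTransferRun.transferRegret_le`, for `h = 0` and `h =
meanTask ρ`.

For one task, the estimation error is `V_t⁻¹ (lam (h - w) + S_t)`, with `S_t` the noise sum.
Cauchy–Schwarz for the form `V_t⁻¹` and optimism bound the regret of a round by twice the confidence
radius times the width `‖x_t‖` in the `V_t⁻¹` norm, as long as `‖S_t‖` in that norm is at most the
noise part of the radius. The method of mixtures controls `S_t`: `lintegral_gaussianMixture_le_one`
says that `exp (‖S_t‖² / 2)`, normalised by determinants, has expectation at most 1. By Markov's
inequality a given round is bad with probability at most `1 / T`. A bad round costs at most 2, so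
bad rounds cost 2 altogether and no bound uniform in time is needed. The widths are summed by the
elliptical potential bound.

The additive 2 is too much for small variance, since the target tends to 0. Put `z = L² T² V / d`.
If `d log (1 + z) ≥ 1`, the 2 is absorbed. Otherwise all widths are bounded by `L / √lam` and `‖S_t‖
≤ R M` with `E M ≤ 1`, so expectations can be taken without an exceptional event. The resulting
factor `T L √V = √(d z)` is then comparable to `√(d log (1 + z))`.

This proves the bound with `L²`; Bernoulli's inequality turns it into the one with `L` at the price
of a factor `max 1 L`. -/

lemma dotProduct_mulVec_comm_of_isHermitian {A : Matrix n n ℝ} (hA : A.IsHermitian) (u v : n → ℝ) :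
    u ⬝ᵥ A *ᵥ v = v ⬝ᵥ A *ᵥ u := by
  have h : Aᵀ = A := by simpa [IsHermitian] using hA
  rw [dotProduct_mulVec, ← mulVec_transpose, h, dotProduct_comm]

/-- The form is nonnegative at `u + s • v` for every `s`, so its discriminant in `s` is at most 0.
-/
lemma Matrix.PosSemidef.sq_dotProduct_mulVec_le {A : Matrix n n ℝ} (hA : A.PosSemidef)
    (u v : n → ℝ) : (u ⬝ᵥ A *ᵥ v) ^ 2 ≤ (u ⬝ᵥ A *ᵥ u) * (v ⬝ᵥ A *ᵥ v) := by
  have key : ∀ s : ℝ, 0 ≤ (v ⬝ᵥ A *ᵥ v) * (s * s) + (2 * (u ⬝ᵥ A *ᵥ v)) * s + u ⬝ᵥ A *ᵥ u := by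
    intro s
    have h := hA.dotProduct_mulVec_nonneg (u + s • v)
    simp only [star_trivial, mulVec_add, mulVec_smul, dotProduct_add, add_dotProduct,
      dotProduct_smul, smul_dotProduct, smul_eq_mul] at h
    rw [dotProduct_mulVec_comm_of_isHermitian hA.1 v u] at h
    linarith
  have := discrim_le_zero key
  rw [discrim] at this
  linarith

/-- With `y = V⁻¹ u`, positivity of `G` gives `c (y ⬝ y) ≤ u ⬝ y`, and Cauchy–Schwarz for `u ⬝ y`
removes `y`. No diagonalisation is needed. -/
lemma Matrix.PosDef.inv_dotProduct_mulVec_le [DecidableEq n] {G : Matrix n n ℝ}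
    (hG : G.PosSemidef) {c : ℝ} (hc : 0 < c) (u : n → ℝ) :
    u ⬝ᵥ (c • (1 : Matrix n n ℝ) + G)⁻¹ *ᵥ u ≤ (u ⬝ᵥ u) / c := by
  have hV : (c • (1 : Matrix n n ℝ) + G).PosDef := (PosDef.one.smul hc).add_posSemidef hG
  set V := c • (1 : Matrix n n ℝ) + G with hVdef
  set y := V⁻¹ *ᵥ u with hy
  have hu : V *ᵥ y = u := by
    rw [hy, mulVec_mulVec, mul_nonsing_inv _ ((isUnit_iff_isUnit_det _).1 hV.isUnit), one_mulVec]
  have h1 : c * (y ⬝ᵥ y) ≤ u ⬝ᵥ y := by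
    have h := hG.dotProduct_mulVec_nonneg y
    rw [star_trivial] at h
    have hu' : u ⬝ᵥ y = y ⬝ᵥ V *ᵥ y := by rw [hu, dotProduct_comm]
    rw [hu', hVdef, add_mulVec, smul_mulVec, one_mulVec, dotProduct_add,
      dotProduct_smul, smul_eq_mul]
    linarith
  have h2 : (u ⬝ᵥ y) ^ 2 ≤ (u ⬝ᵥ u) * (y ⬝ᵥ y) := by
    classical
    simpa using (PosSemidef.one (n := n) (R := ℝ)).sq_dotProduct_mulVec_le u y
  rw [le_div_iff₀ hc]
  have h0 : 0 ≤ y ⬝ᵥ y := by simpa using dotProduct_star_self_nonneg y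
  have h0' : 0 ≤ u ⬝ᵥ u := by simpa using dotProduct_star_self_nonneg u
  by_contra! hcon
  have h3 : 0 < u ⬝ᵥ y := pos_of_mul_pos_left (h0'.trans_lt hcon) hc.le
  nlinarith [mul_le_mul_of_nonneg_left h1 h0', mul_lt_mul_of_pos_right hcon h3]

lemma one_add_inv_form_pos [DecidableEq n] {V : Matrix n n ℝ} (hV : V.PosDef) (x : n → ℝ) :
    0 < 1 + x ⬝ᵥ V⁻¹ *ᵥ x := by
  have := hV.inv.posSemidef.dotProduct_mulVec_nonneg x
  rw [star_trivial] at this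
  linarith

lemma posDef_add_vecMulVec {V : Matrix n n ℝ} (hV : V.PosDef) (x : n → ℝ) :
    (V + vecMulVec x x).PosDef := by
  have := posSemidef_vecMulVec_self_star x
  rw [star_trivial] at this
  exact hV.add_posSemidef this

lemma det_add_vecMulVec_self [DecidableEq n] {V : Matrix n n ℝ} (hV : V.PosDef) (x : n → ℝ) :
    (V + vecMulVec x x).det = V.det * (1 + x ⬝ᵥ V⁻¹ *ᵥ x) := by
  rw [vecMulVec_eq Unit, det_add_replicateCol_mul_replicateRow
    ((isUnit_iff_isUnit_det _).1 hV.isUnit)]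
  congr 1
  rw [← replicateRow_vecMul, replicateRow_mul_replicateCol, det_unique]
  simp [dotProduct_mulVec]

/-- Sherman–Morrison, checked by applying `V + x xᵀ` to the right-hand side. -/
lemma inv_add_vecMulVec_mulVec [DecidableEq n] {V : Matrix n n ℝ} (hV : V.PosDef) (x u : n → ℝ) :
    (V + vecMulVec x x)⁻¹ *ᵥ u
      = V⁻¹ *ᵥ u - ((x ⬝ᵥ V⁻¹ *ᵥ u) / (1 + x ⬝ᵥ V⁻¹ *ᵥ x)) • (V⁻¹ *ᵥ x) := by
  have hb := one_add_inv_form_pos hV x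
  have hV' := (isUnit_iff_isUnit_det _).1 (posDef_add_vecMulVec hV x).isUnit
  have hVu := (isUnit_iff_isUnit_det _).1 hV.isUnit
  have hinv : ∀ z, V *ᵥ (V⁻¹ *ᵥ z) = z := fun z => by
    rw [mulVec_mulVec, mul_nonsing_inv _ hVu, one_mulVec]
  set y := V⁻¹ *ᵥ u - ((x ⬝ᵥ V⁻¹ *ᵥ u) / (1 + x ⬝ᵥ V⁻¹ *ᵥ x)) • (V⁻¹ *ᵥ x) with hy
  have h : (V + vecMulVec x x) *ᵥ y = u := by
    have hx : ∀ z, vecMulVec x x *ᵥ z = (x ⬝ᵥ z) • x := fun z => by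
      rw [vecMulVec_mulVec]; ext i; simp [mul_comm]
    rw [add_mulVec, hx, hy, mulVec_sub, mulVec_smul, hinv, hinv, dotProduct_sub, dotProduct_smul,
      smul_eq_mul]
    have : x ⬝ᵥ V⁻¹ *ᵥ u - (x ⬝ᵥ V⁻¹ *ᵥ u) / (1 + x ⬝ᵥ V⁻¹ *ᵥ x) * (x ⬝ᵥ V⁻¹ *ᵥ x)
        = (x ⬝ᵥ V⁻¹ *ᵥ u) / (1 + x ⬝ᵥ V⁻¹ *ᵥ x) := by
      field_simp
      ring
    rw [this]
    abel
  rw [← h, mulVec_mulVec, nonsing_inv_mul _ hV', one_mulVec]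

/-- The increment involves `S` only through the scalar `xᵀ V⁻¹ S`, which reduces the mixture
argument to one dimension. -/
lemma inv_form_add_vecMulVec [DecidableEq n] {V : Matrix n n ℝ} (hV : V.PosDef) (x S : n → ℝ)
    (r : ℝ) :
    (S + r • x) ⬝ᵥ (V + vecMulVec x x)⁻¹ *ᵥ (S + r • x)
      = S ⬝ᵥ V⁻¹ *ᵥ S + (2 * r * (x ⬝ᵥ V⁻¹ *ᵥ S) + r ^ 2 * (x ⬝ᵥ V⁻¹ *ᵥ x)
          - (x ⬝ᵥ V⁻¹ *ᵥ S) ^ 2) / (1 + x ⬝ᵥ V⁻¹ *ᵥ x) := by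
  have hb := one_add_inv_form_pos hV x
  rw [inv_add_vecMulVec_mulVec hV]
  simp only [mulVec_add, mulVec_smul, dotProduct_add, add_dotProduct, dotProduct_sub,
    dotProduct_smul, smul_dotProduct, smul_eq_mul]
  rw [dotProduct_mulVec_comm_of_isHermitian hV.inv.1 S x]
  field_simp
  ring

/-- The inequality of arithmetic and geometric means for the eigenvalues. -/
lemma Matrix.PosSemidef.det_le_trace_div_card_pow [DecidableEq n] [Nonempty n] {A : Matrix n n ℝ}
    (hA : A.PosSemidef) : A.det ≤ (A.trace / Fintype.card n) ^ Fintype.card n := by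
  have hdet := hA.1.det_eq_prod_eigenvalues
  have htr := hA.1.trace_eq_sum_eigenvalues
  simp only [RCLike.ofReal_real_eq_id, id] at hdet htr
  have hcard : (0 : ℝ) < Fintype.card n := by exact_mod_cast Fintype.card_pos
  have h0 : ∀ i, 0 ≤ hA.1.eigenvalues i := hA.eigenvalues_nonneg
  have h := Real.geom_mean_le_arith_mean Finset.univ (fun _ => (1 : ℝ)) hA.1.eigenvalues
    (by simp) (by simpa using hcard) (by simpa using h0)
  simp only [Real.rpow_one, Finset.sum_const, Finset.card_univ, nsmul_eq_mul, mul_one,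
    one_mul] at h
  rw [← hdet, ← htr] at h
  have hd : 0 ≤ A.det := by rw [hdet]; exact Finset.prod_nonneg fun i _ => h0 i
  calc A.det = (A.det ^ ((Fintype.card n : ℝ)⁻¹)) ^ Fintype.card n := by
        rw [Real.rpow_inv_natCast_pow hd Fintype.card_ne_zero]
    _ ≤ _ := pow_le_pow_left₀ (Real.rpow_nonneg hd _) h _

end LinearAlgebra

/-! ### Growth of the design matrix and the elliptical potential. -/

section DesignMatrix

open Matrix

variable {d : ℕ} {lam : ℝ} {x : ℕ → EuclideanSpace ℝ (Fin d)}

lemma designMatrix_succ (lam : ℝ) (x : ℕ → EuclideanSpace ℝ (Fin d)) (t : ℕ) :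
    designMatrix lam x (t + 1) = designMatrix lam x t + vecMulVec (x t).ofLp (x t).ofLp := by
  rw [designMatrix, designMatrix, Finset.sum_range_succ, add_assoc]

lemma posSemidef_sum_vecMulVec (x : ℕ → EuclideanSpace ℝ (Fin d)) (t : ℕ) :
    (∑ s ∈ Finset.range t, vecMulVec (x s).ofLp (x s).ofLp).PosSemidef := by
  refine posSemidef_sum _ fun s _ => ?_
  have := posSemidef_vecMulVec_self_star (x s).ofLp
  rwa [star_trivial] at this

lemma posDef_designMatrix (hlam : 0 < lam) (x : ℕ → EuclideanSpace ℝ (Fin d)) (t : ℕ) :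
    (designMatrix lam x t).PosDef :=
  (PosDef.one.smul hlam).add_posSemidef (posSemidef_sum_vecMulVec x t)

lemma dotProduct_ofLp_self (v : EuclideanSpace ℝ (Fin d)) : v.ofLp ⬝ᵥ v.ofLp = ‖v‖ ^ 2 := by
  rw [EuclideanSpace.real_norm_sq_eq]
  simp [dotProduct, sq]

lemma inner_eq_dotProduct_ofLp (u v : EuclideanSpace ℝ (Fin d)) :
    inner ℝ u v = u.ofLp ⬝ᵥ v.ofLp := by
  simp [PiLp.inner_apply, dotProduct, mul_comm]

lemma weightedNorm_nonneg (A : Matrix (Fin d) (Fin d) ℝ) (v : EuclideanSpace ℝ (Fin d)) :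
    0 ≤ weightedNorm A v := Real.sqrt_nonneg _

lemma sq_weightedNorm {A : Matrix (Fin d) (Fin d) ℝ} (hA : A.PosSemidef)
    (v : EuclideanSpace ℝ (Fin d)) : weightedNorm A v ^ 2 = v.ofLp ⬝ᵥ A *ᵥ v.ofLp :=
  Real.sq_sqrt (by simpa using hA.dotProduct_mulVec_nonneg v.ofLp)

lemma abs_form_le_weightedNorm_mul {A : Matrix (Fin d) (Fin d) ℝ} (hA : A.PosSemidef)
    (u v : EuclideanSpace ℝ (Fin d)) :
    |u.ofLp ⬝ᵥ A *ᵥ v.ofLp| ≤ weightedNorm A u * weightedNorm A v := by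
  refine abs_le_of_sq_le_sq ?_ (mul_nonneg (weightedNorm_nonneg _ _) (weightedNorm_nonneg _ _))
  rw [mul_pow, sq_weightedNorm hA, sq_weightedNorm hA]
  exact hA.sq_dotProduct_mulVec_le _ _

lemma weightedNorm_inv_designMatrix_le (hlam : 0 < lam) (x : ℕ → EuclideanSpace ℝ (Fin d)) (t : ℕ)
    (v : EuclideanSpace ℝ (Fin d)) :
    weightedNorm (designMatrix lam x t)⁻¹ v ≤ ‖v‖ / √lam := by
  refine Real.sqrt_le_iff.2 ⟨by positivity, ?_⟩
  rw [div_pow, Real.sq_sqrt hlam.le, ← dotProduct_ofLp_self]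
  exact PosDef.inv_dotProduct_mulVec_le (posSemidef_sum_vecMulVec x t) hlam _

lemma det_designMatrix_succ (hlam : 0 < lam) (x : ℕ → EuclideanSpace ℝ (Fin d)) (t : ℕ) :
    (designMatrix lam x (t + 1)).det = (designMatrix lam x t).det
      * (1 + weightedNorm (designMatrix lam x t)⁻¹ (x t) ^ 2) := by
  rw [designMatrix_succ, det_add_vecMulVec_self (posDef_designMatrix hlam x t),
    sq_weightedNorm (posDef_designMatrix hlam x t).inv.posSemidef]

lemma det_smul_one_le_det_designMatrix (hlam : 0 < lam) (x : ℕ → EuclideanSpace ℝ (Fin d))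
    (t : ℕ) : (lam • (1 : Matrix (Fin d) (Fin d) ℝ)).det ≤ (designMatrix lam x t).det := by
  induction t with
  | zero => simp [designMatrix]
  | succ t ih =>
    rw [det_designMatrix_succ hlam]
    have := (posDef_designMatrix hlam x t).det_pos
    nlinarith [sq_nonneg (weightedNorm (designMatrix lam x t)⁻¹ (x t)),
      mul_nonneg this.le (sq_nonneg (weightedNorm (designMatrix lam x t)⁻¹ (x t)))]

lemma det_smul_one_pos (hlam : 0 < lam) : 0 < (lam • (1 : Matrix (Fin d) (Fin d) ℝ)).det :=
  (PosDef.one.smul hlam).det_pos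

/-- The logarithm of `det V_t / det (lam I)`. -/
noncomputable def logDetRatio (lam : ℝ) (x : ℕ → EuclideanSpace ℝ (Fin d)) (t : ℕ) : ℝ :=
  Real.log ((designMatrix lam x t).det / (lam • (1 : Matrix (Fin d) (Fin d) ℝ)).det)

lemma logDetRatio_nonneg (hlam : 0 < lam) (x : ℕ → EuclideanSpace ℝ (Fin d)) (t : ℕ) :
    0 ≤ logDetRatio lam x t :=
  Real.log_nonneg ((one_le_div (det_smul_one_pos hlam)).2
    (det_smul_one_le_det_designMatrix hlam x t))

lemma logDetRatio_zero (hlam : 0 < lam) (x : ℕ → EuclideanSpace ℝ (Fin d)) :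
    logDetRatio lam x 0 = 0 := by
  rw [logDetRatio, designMatrix, Finset.sum_range_zero, add_zero,
    div_self (det_smul_one_pos hlam).ne', Real.log_one]

lemma logDetRatio_succ (hlam : 0 < lam) (x : ℕ → EuclideanSpace ℝ (Fin d)) (t : ℕ) :
    logDetRatio lam x (t + 1) = logDetRatio lam x t
      + Real.log (1 + weightedNorm (designMatrix lam x t)⁻¹ (x t) ^ 2) := by
  have h1 := det_smul_one_pos (d := d) hlam
  have h2 := (posDef_designMatrix hlam x t).det_pos
  rw [logDetRatio, det_designMatrix_succ hlam, mul_div_right_comm, Real.log_mul (by positivity)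
    (by positivity), logDetRatio]

/-- The trace is linear in the arms and at most `d * lam + T * L ^ 2`; the determinant is bounded
through it. -/
lemma logDetRatio_le [NeZero d] (hlam : 0 < lam) {L : ℝ} {t T : ℕ} (ht : t ≤ T)
    (hx : ∀ s < t, ‖x s‖ ≤ L) :
    logDetRatio lam x t ≤ d * Real.log (1 + T * L ^ 2 / (lam * d)) := by
  have hd : (0 : ℝ) < d := by exact_mod_cast Nat.pos_of_ne_zero (NeZero.ne d)
  have h := (posDef_designMatrix hlam x t).posSemidef.det_le_trace_div_card_pow
  have htr : (designMatrix lam x t).trace ≤ d * lam + T * L ^ 2 := by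
    rw [designMatrix, trace_add, trace_smul, trace_one, trace_sum]
    have : ∑ s ∈ Finset.range t, (vecMulVec (x s).ofLp (x s).ofLp).trace
        ≤ ∑ s ∈ Finset.range t, L ^ 2 := by
      refine Finset.sum_le_sum fun s hs => ?_
      rw [trace_vecMulVec, dotProduct_ofLp_self]
      exact pow_le_pow_left₀ (norm_nonneg _) (hx s (Finset.mem_range.1 hs)) 2
    rw [Finset.sum_const, Finset.card_range, nsmul_eq_mul] at this
    have h3 : (t : ℝ) * L ^ 2 ≤ T * L ^ 2 := by gcongr
    simp only [Fintype.card_fin, smul_eq_mul]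
    linarith
  have htr0 : 0 ≤ (designMatrix lam x t).trace :=
    (posDef_designMatrix hlam x t).posSemidef.trace_nonneg
  rw [Fintype.card_fin] at h
  rw [logDetRatio, ← Real.log_pow]
  refine Real.log_le_log (div_pos (posDef_designMatrix hlam x t).det_pos (det_smul_one_pos hlam)) ?_
  rw [det_smul, det_one, mul_one, Fintype.card_fin, div_le_iff₀ (by positivity), ← mul_pow]
  refine h.trans (pow_le_pow_left₀ (by positivity) ?_ _)
  rw [div_le_iff₀ hd]
  refine htr.trans (le_of_eq ?_)
  field_simp

/-- For `m = min 1 b ^ 2 ≤ 1` one has `log (1 + m) ≥ m / (1 + m) ≥ m / 2`. The truncation at 1 is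
harmless for the regret because a single round costs at most 2. -/
lemma min_one_sq_le_two_mul_log {b : ℝ} (hb : 0 ≤ b) :
    min 1 b ^ 2 ≤ 2 * Real.log (1 + b ^ 2) := by
  have hm0 : 0 ≤ min 1 b := le_min zero_le_one hb
  have h1 : min 1 b ^ 2 ≤ 1 := pow_le_one₀ hm0 (min_le_left _ _)
  have h2 : min 1 b ^ 2 ≤ b ^ 2 := pow_le_pow_left₀ hm0 (min_le_right _ _) 2
  have h3 := Real.one_sub_inv_le_log_of_pos (x := 1 + min 1 b ^ 2) (by positivity)
  have h4 : Real.log (1 + min 1 b ^ 2) ≤ Real.log (1 + b ^ 2) :=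
    Real.log_le_log (by positivity) (by linarith)
  have h5 : min 1 b ^ 2 / 2 ≤ 1 - (1 + min 1 b ^ 2)⁻¹ := by
    have h0 := sq_nonneg (min 1 b)
    generalize min 1 b ^ 2 = m at *
    rw [le_sub_iff_add_le, ← le_sub_iff_add_le', inv_le_iff_one_le_mul₀ (by positivity)]
    nlinarith
  linarith

/-- The elliptical potential bound. -/
lemma sum_min_one_weightedNorm_sq_le (hlam : 0 < lam) (x : ℕ → EuclideanSpace ℝ (Fin d)) (T : ℕ) :
    ∑ t ∈ Finset.range T, min 1 (weightedNorm (designMatrix lam x t)⁻¹ (x t)) ^ 2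
      ≤ 2 * logDetRatio lam x T := by
  induction T with
  | zero => simp [logDetRatio_zero hlam]
  | succ T ih =>
    rw [Finset.sum_range_succ, logDetRatio_succ hlam]
    have := min_one_sq_le_two_mul_log 
      (weightedNorm_nonneg (designMatrix lam x T)⁻¹ (x T))
    linarith

lemma sum_min_one_weightedNorm_le (hlam : 0 < lam) (x : ℕ → EuclideanSpace ℝ (Fin d)) (T : ℕ) :
    ∑ t ∈ Finset.range T, min 1 (weightedNorm (designMatrix lam x t)⁻¹ (x t))
      ≤ √(2 * T * logDetRatio lam x T) := by
  refine Real.le_sqrt_of_sq_le ?_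
  have h := sq_sum_le_card_mul_sum_sq (s := Finset.range T)
    (f := fun t => min 1 (weightedNorm (designMatrix lam x t)⁻¹ (x t)))
  rw [Finset.card_range] at h
  have h2 := mul_le_mul_of_nonneg_left (sum_min_one_weightedNorm_sq_le hlam x T)
    (Nat.cast_nonneg (α := ℝ) T)
  linarith

end DesignMatrix

/-! ### Conditional sub-Gaussian bounds with random exponents, and Gaussian averaging. -/

section SubGaussian

open scoped ENNReal

variable {Ω : Type*} {m mΩ : MeasurableSpace Ω} {P : Measure Ω} {X : Ω → ℝ} {R : ℝ}

/-- Tested on sets of `m`, the conditional bound says that the measure with density `exp (s X)`,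
trimmed to `m`, is dominated by a multiple of the trimmed `P`. Integrating `W` against both measures
requires no integrability of `W`. -/
lemma IsCondSubGaussian.lintegral_const_le [IsProbabilityMeasure P]
    (hX : IsCondSubGaussian m P X R) (hm : m ≤ mΩ) (s : ℝ) {W : Ω → ℝ≥0∞}
    (hW : Measurable[m] W) :
    ∫⁻ ω, W ω * ENNReal.ofReal (Real.exp (s * X ω)) ∂P
      ≤ ENNReal.ofReal (Real.exp (s ^ 2 * R ^ 2 / 2)) * ∫⁻ ω, W ω ∂P := by
  obtain ⟨hint, hle⟩ := hX s
  set f : Ω → ℝ≥0∞ := fun ω => ENNReal.ofReal (Real.exp (s * X ω)) with hf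
  have hfm : AEMeasurable f P := hint.1.aemeasurable.ennreal_ofReal
  have key : (P.withDensity f).trim hm
      ≤ ENNReal.ofReal (Real.exp (s ^ 2 * R ^ 2 / 2)) • P.trim hm := by
    refine Measure.le_iff.2 fun A hA => ?_
    rw [trim_measurableSet_eq hm hA, withDensity_apply _ (hm A hA), Measure.smul_apply,
      trim_measurableSet_eq hm hA, smul_eq_mul,
      ← ofReal_integral_eq_lintegral_ofReal hint.integrableOn
        (ae_of_all _ fun ω => (Real.exp_pos _).le), ← setIntegral_condExp hm hint hA]
    calc ENNReal.ofReal (∫ ω in A, (P[fun ω => Real.exp (s * X ω) | m]) ω ∂P)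
        ≤ ENNReal.ofReal (∫ ω in A, Real.exp (s ^ 2 * R ^ 2 / 2) ∂P) :=
          ENNReal.ofReal_le_ofReal (setIntegral_mono_ae integrable_condExp.integrableOn
            (integrable_const _).integrableOn hle)
      _ = _ := by
          rw [setIntegral_const, smul_eq_mul, mul_comm, ENNReal.ofReal_mul (Real.exp_pos _).le,
            ofReal_measureReal]
  calc ∫⁻ ω, W ω * f ω ∂P = ∫⁻ ω, W ω ∂(P.withDensity f) := by
        rw [lintegral_withDensity_eq_lintegral_mul₀ hfm (hW.mono hm le_rfl).aemeasurable]
        simp [mul_comm]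
    _ = ∫⁻ ω, W ω ∂((P.withDensity f).trim hm) := (lintegral_trim hm hW).symm
    _ ≤ ∫⁻ ω, W ω ∂(ENNReal.ofReal (Real.exp (s ^ 2 * R ^ 2 / 2)) • P.trim hm) :=
        lintegral_mono' key le_rfl
    _ = _ := by rw [lintegral_smul_measure, lintegral_trim hm hW, smul_eq_mul]

/-- `r` rounded towards `0` to a multiple of `1 / (n + 1)`, as a multiple of `1 / (n + 1)`. -/
noncomputable def roundToZero (n : ℕ) (r : ℝ) : ℤ := if 0 ≤ r then ⌊(n + 1) * r⌋ else ⌈(n + 1) * r⌉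

lemma measurable_roundToZero (n : ℕ) : Measurable (roundToZero n) :=
  Measurable.ite measurableSet_Ici (Int.measurable_floor.comp (measurable_const_mul _))
    (Int.measurable_ceil.comp (measurable_const_mul _))

/-- This is why the rounding goes towards 0: the bound `exp (c² R² / 2)` does not increase when `c`
is discretised. -/
lemma sq_roundToZero_div_le (n : ℕ) (r : ℝ) : ((roundToZero n r : ℝ) / (n + 1)) ^ 2 ≤ r ^ 2 := by
  have hn : (0 : ℝ) < n + 1 := by positivity
  rw [sq_le_sq, abs_div, abs_of_pos hn, div_le_iff₀ hn, roundToZero]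
  split_ifs with h
  · have h0 : (0 : ℝ) ≤ ⌊(n + 1) * r⌋ := by
      exact_mod_cast Int.floor_nonneg.2 (mul_nonneg hn.le h)
    rw [abs_of_nonneg h0, abs_of_nonneg h, mul_comm]
    exact Int.floor_le _
  · push Not at h
    have h0 : (⌈(n + 1) * r⌉ : ℝ) ≤ 0 := by
      exact_mod_cast Int.ceil_le.2 (by push_cast; nlinarith)
    rw [abs_of_nonpos h0, abs_of_neg h]
    have := Int.le_ceil ((n + 1) * r)
    linarith

lemma tendsto_roundToZero_div (r : ℝ) :
    Tendsto (fun n : ℕ => (roundToZero n r : ℝ) / (n + 1)) atTop (𝓝 r) := by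
  have h : ∀ n : ℕ, dist ((roundToZero n r : ℝ) / (n + 1)) r ≤ 1 / ((n : ℝ) + 1) := by
    intro n
    have hn : (0 : ℝ) < n + 1 := by positivity
    rw [Real.dist_eq, div_sub' hn.ne', abs_div, abs_of_pos hn]
    gcongr
    rw [roundToZero, abs_le]
    split_ifs
    · have := Int.floor_le ((n + 1) * r)
      have := Int.lt_floor_add_one ((n + 1) * r)
      constructor <;> linarith
    · have := Int.le_ceil ((n + 1) * r)
      have := Int.ceil_lt_add_one ((n + 1) * r)
      constructor <;> linarith
  exact tendsto_iff_dist_tendsto_zero.2 (squeeze_zero (fun _ => dist_nonneg) h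
    tendsto_one_div_add_atTop_nhds_zero_nat)

/-- In the conditional sub-Gaussian bound the exponent may be any random variable that is
measurable with respect to the conditioning σ-algebra. -/
lemma IsCondSubGaussian.lintegral_le [IsProbabilityMeasure P]
    (hX : IsCondSubGaussian m P X R) (hXm : Measurable X) (hm : m ≤ mΩ) {c : Ω → ℝ}
    (hc : Measurable[m] c) {W : Ω → ℝ≥0∞} (hW : Measurable[m] W) :
    ∫⁻ ω, W ω * ENNReal.ofReal (Real.exp (c ω * X ω)) ∂P
      ≤ ∫⁻ ω, W ω * ENNReal.ofReal (Real.exp (c ω ^ 2 * R ^ 2 / 2)) ∂P := by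
  set cn : ℕ → Ω → ℝ := fun n ω => (roundToZero n (c ω) : ℝ) / (n + 1) with hcn
  have hk : ∀ n, Measurable[m] fun ω => roundToZero n (c ω) := fun n =>
    (measurable_roundToZero n).comp hc
  have hcnm : ∀ n, Measurable (cn n) := fun n =>
    ((measurable_from_top (f := fun k : ℤ => (k : ℝ))).comp ((hk n).mono hm le_rfl)).div_const _
  have hWm : Measurable W := hW.mono hm le_rfl
  have hstep : ∀ n, ∫⁻ ω, W ω * ENNReal.ofReal (Real.exp (cn n ω * X ω)) ∂P
      ≤ ∫⁻ ω, W ω * ENNReal.ofReal (Real.exp (c ω ^ 2 * R ^ 2 / 2)) ∂P := by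
    intro n
    -- On each of these countably many level sets, which lie in `m`, the rounded exponent is
    -- constant.
    set A : ℤ → Set Ω := fun i => (fun ω => roundToZero n (c ω)) ⁻¹' {i} with hA
    have hAm : ∀ i, MeasurableSet[m] (A i) := fun i => hk n (measurableSet_singleton i)
    have hU : ⋃ i, A i = Set.univ := by ext; simp [hA]
    have hdisj : Pairwise (Function.onFun Disjoint A) := by
      intro i j hij
      exact Disjoint.preimage _ (Set.disjoint_singleton.2 hij)
    rw [← setLIntegral_univ, ← setLIntegral_univ (μ := P), ← hU,
      lintegral_iUnion (fun i => hm _ (hAm i)) hdisj,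
      lintegral_iUnion (fun i => hm _ (hAm i)) hdisj]
    refine ENNReal.tsum_le_tsum fun i => ?_
    have h := hX.lintegral_const_le hm ((i : ℝ) / (n + 1)) (hW.indicator (hAm i))
    rw [← lintegral_indicator (hm _ (hAm i)), ← lintegral_indicator (hm _ (hAm i))]
    rw [← lintegral_const_mul _ (hWm.indicator (hm _ (hAm i)))] at h
    refine le_trans (le_of_eq (lintegral_congr fun ω => ?_)) (h.trans (lintegral_mono fun ω => ?_))
    · by_cases hω : ω ∈ A i
      · have : roundToZero n (c ω) = i := hω
        simp [hω, hcn, this]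
      · simp [hω]
    · by_cases hω : ω ∈ A i
      · have h1 : roundToZero n (c ω) = i := hω
        have h2 := sq_roundToZero_div_le n (c ω)
        rw [h1] at h2
        simp only [hω, Set.indicator_of_mem]
        rw [mul_comm]
        gcongr
      · simp [hω]
  have hlim : ∀ ω, Tendsto (fun n => W ω * ENNReal.ofReal (Real.exp (cn n ω * X ω))) atTop
      (𝓝 (W ω * ENNReal.ofReal (Real.exp (c ω * X ω)))) := by
    intro ω
    -- `W ω` may be infinite; multiplication by it is still continuous at the limit, which is
    -- positive.
    refine ENNReal.Tendsto.const_mul ?_ (Or.inl (by simp [Real.exp_pos]))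
    exact ENNReal.tendsto_ofReal ((Real.continuous_exp.tendsto _).comp
      ((tendsto_roundToZero_div (c ω)).mul_const _))
  calc ∫⁻ ω, W ω * ENNReal.ofReal (Real.exp (c ω * X ω)) ∂P
      = ∫⁻ ω, liminf (fun n => W ω * ENNReal.ofReal (Real.exp (cn n ω * X ω))) atTop ∂P :=
        lintegral_congr fun ω => (hlim ω).liminf_eq.symm
    _ ≤ liminf (fun n => ∫⁻ ω, W ω * ENNReal.ofReal (Real.exp (cn n ω * X ω)) ∂P) atTop :=
        lintegral_liminf_le fun n => hWm.mul ((hcnm n).mul hXm).exp.ennreal_ofReal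
    _ ≤ _ := liminf_le_of_le (h := fun b hb => by
        obtain ⟨n, hn⟩ := hb.exists
        exact hn.trans (hstep n))

lemma lintegral_exp_affine_mul_gaussianReal (μ s y : ℝ) :
    ∫⁻ g, ENNReal.ofReal (Real.exp ((μ + s * g) * y)) ∂(gaussianReal 0 1)
      = ENNReal.ofReal (Real.exp (μ * y + s ^ 2 * y ^ 2 / 2)) := by
  have hmgf := mgf_gaussianReal (p := gaussianReal 0 1) (X := id) (μ := 0) (v := 1) (by simp)
    (s * y)
  have hint : Integrable (fun g => Real.exp (s * y * g)) (gaussianReal 0 1) :=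
    integrable_exp_mul_gaussianReal _
  have h : ∀ g : ℝ, Real.exp ((μ + s * g) * y) = Real.exp (μ * y) * Real.exp (s * y * g) := by
    intro g
    rw [← Real.exp_add]
    ring_nf
  simp_rw [h]
  rw [← ofReal_integral_eq_lintegral_ofReal (hint.const_mul _)
    (ae_of_all _ fun g => by positivity), integral_const_mul]
  congr 1
  rw [Real.exp_add]
  congr 1
  rw [mgf] at hmgf
  simpa [mul_pow] using hmgf

/-- Completing the square turns the integrand times the standard Gaussian density into a constant
times the density with mean `s * a` and variance `1 + b`. -/
lemma lintegral_exp_sq_affine_gaussianReal {a b s : ℝ} (hb : 0 ≤ b) (hs : s ^ 2 = b / (1 + b)) :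
    ∫⁻ g, ENNReal.ofReal (Real.exp ((a / (1 + b) + s * g) ^ 2 / 2)) ∂(gaussianReal 0 1)
      = ENNReal.ofReal (√(1 + b) * Real.exp (a ^ 2 / (2 * (1 + b)))) := by
  have hb1 : 0 < 1 + b := by linarith
  set v : NNReal := ⟨1 + b, hb1.le⟩ with hv
  have hv0 : v ≠ 0 := fun h => hb1.ne' (congrArg NNReal.toReal h)
  have hvr : (v : ℝ) = 1 + b := rfl
  rw [gaussianReal_of_var_ne_zero _ one_ne_zero,
    lintegral_withDensity_eq_lintegral_mul₀ (measurable_gaussianPDF _ _).aemeasurable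
      (by fun_prop)]
  have h : ∀ g : ℝ, (gaussianPDF 0 1 * fun g : ℝ =>
      ENNReal.ofReal (Real.exp ((a / (1 + b) + s * g) ^ 2 / 2))) g
      = ENNReal.ofReal (√(1 + b) * Real.exp (a ^ 2 / (2 * (1 + b)))) * gaussianPDF (s * a) v g := by
    intro g
    rw [Pi.mul_apply, gaussianPDF, gaussianPDF, ← ENNReal.ofReal_mul (gaussianPDFReal_nonneg _ _ _),
      ← ENNReal.ofReal_mul (by positivity), gaussianPDFReal, gaussianPDFReal, hvr]
    congr 1
    have h1 : √(2 * Real.pi * (1 + b)) = √(2 * Real.pi) * √(1 + b) := Real.sqrt_mul (by positivity) _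
    have h2 : 0 < √(1 + b) := Real.sqrt_pos.2 hb1
    have h3 : -(g - 0) ^ 2 / (2 * 1) + (a / (1 + b) + s * g) ^ 2 / 2
        = a ^ 2 / (2 * (1 + b)) + -(g - s * a) ^ 2 / (2 * (1 + b)) := by
      have : (a / (1 + b) + s * g) ^ 2
        = (a / (1 + b)) ^ 2 + 2 * (a / (1 + b)) * s * g + b / (1 + b) * g ^ 2 := by
          rw [← hs]; ring
      rw [this, show (g - s * a) ^ 2 = g ^ 2 - 2 * g * s * a + b / (1 + b) * a ^ 2 by
        rw [← hs]; ring]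
      field_simp
      ring
    rw [h1, NNReal.coe_one, mul_one, mul_assoc, ← Real.exp_add, h3, Real.exp_add]
    field_simp
  simp_rw [h]
  rw [lintegral_const_mul _ (measurable_gaussianPDF _ _), lintegral_gaussianPDF_eq_one _ hv0,
    mul_one]

/-- The one-step bound of the method of mixtures. -/
lemma IsCondSubGaussian.lintegral_mixture_le [IsProbabilityMeasure P]
    (hX : IsCondSubGaussian m P X 1) (hXm : Measurable X) (hm : m ≤ mΩ) {a b : Ω → ℝ}
    (ha : Measurable[m] a) (hb : Measurable[m] b) (hb0 : ∀ ω, 0 ≤ b ω) {W : Ω → ℝ≥0∞}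
    (hW : Measurable[m] W) :
    ∫⁻ ω, W ω * ENNReal.ofReal (Real.exp
        ((2 * X ω * a ω + X ω ^ 2 * b ω - a ω ^ 2) / (2 * (1 + b ω)))) ∂P
      ≤ ∫⁻ ω, W ω * ENNReal.ofReal (√(1 + b ω)) ∂P := by
  set s : Ω → ℝ := fun ω => √(b ω / (1 + b ω)) with hsdef
  have hs : ∀ ω, s ω ^ 2 = b ω / (1 + b ω) := fun ω =>
    Real.sq_sqrt (div_nonneg (hb0 ω) (by linarith [hb0 ω]))
  have hsm : Measurable[m] s := (hb.div (hb.const_add 1)).sqrt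
  -- The part of the exponent free of `X` goes into the weight. The rest is a Gaussian average of
  -- exponentials linear in `X`, to which the sub-Gaussian bound applies for each fixed `g`.
  set W' : Ω → ℝ≥0∞ := fun ω => W ω * ENNReal.ofReal (Real.exp (-(a ω ^ 2 / (2 * (1 + b ω)))))
    with hW'
  have hW'm : Measurable[m] W' :=
    hW.mul ((ha.pow_const 2).div ((hb.const_add 1).const_mul 2)).neg.exp.ennreal_ofReal
  have hμm : Measurable[m] fun ω => a ω / (1 + b ω) := ha.div (hb.const_add 1)
  have hcm : Measurable fun p : Ω × ℝ => a p.1 / (1 + b p.1) + s p.1 * p.2 :=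
    ((hμm.mono hm le_rfl).comp measurable_fst).add
      (((hsm.mono hm le_rfl).comp measurable_fst).mul measurable_snd)
  have hW'm2 : Measurable fun p : Ω × ℝ => W' p.1 := (hW'm.mono hm le_rfl).comp measurable_fst
  calc ∫⁻ ω, W ω * ENNReal.ofReal (Real.exp
        ((2 * X ω * a ω + X ω ^ 2 * b ω - a ω ^ 2) / (2 * (1 + b ω)))) ∂P
      = ∫⁻ ω, ∫⁻ g, W' ω * ENNReal.ofReal (Real.exp ((a ω / (1 + b ω) + s ω * g) * X ω))
          ∂(gaussianReal 0 1) ∂P := by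
        refine lintegral_congr fun ω => ?_
        have h1 : 0 < 1 + b ω := by linarith [hb0 ω]
        rw [lintegral_const_mul _ (by fun_prop), lintegral_exp_affine_mul_gaussianReal, hW',
          mul_assoc (W ω), ← ENNReal.ofReal_mul (Real.exp_pos _).le, ← Real.exp_add, hs]
        congr 3
        field_simp
        ring
    _ = ∫⁻ g, ∫⁻ ω, W' ω * ENNReal.ofReal (Real.exp ((a ω / (1 + b ω) + s ω * g) * X ω))
          ∂P ∂(gaussianReal 0 1) :=
        lintegral_lintegral_swap
          (hW'm2.mul (hcm.mul (hXm.comp measurable_fst)).exp.ennreal_ofReal).aemeasurable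
    _ ≤ ∫⁻ g, ∫⁻ ω, W' ω * ENNReal.ofReal (Real.exp ((a ω / (1 + b ω) + s ω * g) ^ 2 * 1 ^ 2 / 2))
          ∂P ∂(gaussianReal 0 1) :=
        lintegral_mono fun g => hX.lintegral_le hXm hm (hμm.add (hsm.mul_const g)) hW'm
    _ = ∫⁻ ω, ∫⁻ g, W' ω * ENNReal.ofReal (Real.exp ((a ω / (1 + b ω) + s ω * g) ^ 2 * 1 ^ 2 / 2))
          ∂(gaussianReal 0 1) ∂P :=
        (lintegral_lintegral_swap (hW'm2.mul
          (((hcm.pow_const 2).mul_const _).div_const 2).exp.ennreal_ofReal).aemeasurable).symm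
    _ = _ := by
        refine lintegral_congr fun ω => ?_
        have h1 : 0 < 1 + b ω := by linarith [hb0 ω]
        simp only [one_pow, mul_one]
        rw [lintegral_const_mul _ (by fun_prop),
          lintegral_exp_sq_affine_gaussianReal (hb0 ω) (hs ω), hW', mul_assoc,
          ← ENNReal.ofReal_mul (Real.exp_pos _).le, mul_left_comm, ← Real.exp_add, neg_add_cancel,
          Real.exp_zero, mul_one]

lemma IsCondSubGaussian.div (hX : IsCondSubGaussian m P X R)
    (hR : R ≠ 0) : IsCondSubGaussian m P (fun ω => X ω / R) 1 := by
  intro s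
  have h := hX (s / R)
  simp only [div_mul_eq_mul_div, div_pow] at h
  simp only [mul_div_assoc']
  rw [mul_div_cancel_right₀ _ (pow_ne_zero 2 hR)] at h
  simpa using h

/-- The function `exp X + exp (-X) - 2` is nonnegative, vanishes only where `X = 0`, and has
integral at most 0. -/
lemma IsCondSubGaussian.ae_eq_zero [IsProbabilityMeasure P] (hX : IsCondSubGaussian m P X 0)
    (hm : m ≤ mΩ) : ∀ᵐ ω ∂P, X ω = 0 := by
  have hle : ∀ s : ℝ, ∫ ω, Real.exp (s * X ω) ∂P ≤ 1 := by
    intro s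
    obtain ⟨hint, h⟩ := hX s
    rw [← integral_condExp hm]
    calc _ ≤ ∫ ω, Real.exp (s ^ 2 * 0 ^ 2 / 2) ∂P :=
          integral_mono_ae integrable_condExp (integrable_const _) h
      _ = 1 := by simp
  have h0 : ∀ ω, 0 ≤ Real.exp (1 * X ω) + Real.exp (-1 * X ω) - 2 := by
    intro ω
    have h1 := Real.add_one_le_exp (1 * X ω)
    have h2 := Real.add_one_le_exp (-1 * X ω)
    linarith
  have hi : Integrable (fun ω => Real.exp (1 * X ω) + Real.exp (-1 * X ω) - 2) P :=
    ((hX 1).1.add (hX (-1)).1).sub (integrable_const _)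
  have hz : ∫ ω, (Real.exp (1 * X ω) + Real.exp (-1 * X ω) - 2) ∂P = 0 := by
    refine le_antisymm ?_ (integral_nonneg h0)
    rw [integral_sub (f := fun ω => Real.exp (1 * X ω) + Real.exp (-1 * X ω))
      ((hX 1).1.add (hX (-1)).1) (integrable_const _), integral_add (hX 1).1 (hX (-1)).1]
    have h1 := hle 1
    have h2 := hle (-1)
    simp only [integral_const, probReal_univ, one_smul]
    linarith
  filter_upwards [(integral_eq_zero_iff_of_nonneg h0 hi).1 hz] with ω hω
  by_contra hne
  have h1 := Real.add_one_lt_exp (x := 1 * X ω) (by simpa using hne)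
  have h2 := Real.add_one_lt_exp (x := -1 * X ω) (by simpa using hne)
  simp only [Pi.zero_apply] at hω
  linarith

end SubGaussian

/-! ### The self-normalised noise bound by the method of mixtures. -/

section SelfNormalized

open Matrix
open scoped ENNReal

variable {d : ℕ} {lam : ℝ}

/-- The sum `∑_{s < t} ζ_s x_s`. -/
noncomputable def noiseSum (x : ℕ → EuclideanSpace ℝ (Fin d)) (ζ : ℕ → ℝ) (t : ℕ) :
    EuclideanSpace ℝ (Fin d) :=
  ∑ s ∈ Finset.range t, ζ s • x s

/-- The Gaussian mixture `exp (‖S_t‖²_{V_t⁻¹} / 2) (det V_t / det (lam I))^{-1/2}`, where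
`S_t = ∑_{s < t} ζ_s x_s`. -/
noncomputable def gaussianMixture (lam : ℝ) (x : ℕ → EuclideanSpace ℝ (Fin d)) (ζ : ℕ → ℝ) (t : ℕ) :
    ℝ :=
  Real.exp ((weightedNorm (designMatrix lam x t)⁻¹ (noiseSum x ζ t) ^ 2 - logDetRatio lam x t) / 2)

lemma gaussianMixture_zero (hlam : 0 < lam) (x : ℕ → EuclideanSpace ℝ (Fin d)) (ζ : ℕ → ℝ) :
    gaussianMixture lam x ζ 0 = 1 := by
  simp [gaussianMixture, noiseSum, logDetRatio_zero hlam, weightedNorm]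

lemma gaussianMixture_succ (hlam : 0 < lam) (x : ℕ → EuclideanSpace ℝ (Fin d)) (ζ : ℕ → ℝ)
    (t : ℕ) {a b : ℝ}
    (ha : a = (x t).ofLp ⬝ᵥ (designMatrix lam x t)⁻¹ *ᵥ (noiseSum x ζ t).ofLp)
    (hb : b = weightedNorm (designMatrix lam x t)⁻¹ (x t) ^ 2) :
    gaussianMixture lam x ζ (t + 1) = gaussianMixture lam x ζ t / √(1 + b)
      * Real.exp ((2 * ζ t * a + ζ t ^ 2 * b - a ^ 2) / (2 * (1 + b))) := by
  have hV := posDef_designMatrix hlam x t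
  have hb1 : 0 < 1 + b := by rw [hb]; positivity
  have hq : weightedNorm (designMatrix lam x (t + 1))⁻¹ (noiseSum x ζ (t + 1)) ^ 2
      = weightedNorm (designMatrix lam x t)⁻¹ (noiseSum x ζ t) ^ 2
        + (2 * ζ t * a + ζ t ^ 2 * b - a ^ 2) / (1 + b) := by
    rw [sq_weightedNorm (posDef_designMatrix hlam x (t + 1)).inv.posSemidef,
      sq_weightedNorm hV.inv.posSemidef, designMatrix_succ, noiseSum, Finset.sum_range_succ,
      WithLp.ofLp_add, WithLp.ofLp_smul, inv_form_add_vecMulVec hV, ha, hb,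
      sq_weightedNorm hV.inv.posSemidef]
    rfl
  have hs : √(1 + b) = Real.exp (Real.log (1 + b) / 2) := by
    rw [Real.exp_half, Real.exp_log hb1]
  rw [gaussianMixture, gaussianMixture, hq, logDetRatio_succ hlam, ← hb, hs, ← Real.exp_sub,
    ← Real.exp_add]
  congr 1
  field_simp
  ring

section Measurability

variable {Ω : Type*} {m : MeasurableSpace Ω} {x : ℕ → Ω → EuclideanSpace ℝ (Fin d)}
  {ζ : ℕ → Ω → ℝ} {t : ℕ}

lemma stronglyMeasurable_designMatrix (hx : ∀ s < t, StronglyMeasurable[m] (x s)) :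
    StronglyMeasurable[m] fun ω => designMatrix lam (fun s => x s ω) t := by
  refine stronglyMeasurable_const.add
    (Finset.stronglyMeasurable_fun_sum _ fun s hs => ?_)
  have hc : Continuous fun v : EuclideanSpace ℝ (Fin d) => vecMulVec v.ofLp v.ofLp := by
    refine continuous_matrix fun i j => ?_
    simp only [vecMulVec_apply]
    fun_prop
  exact hc.comp_stronglyMeasurable (hx s (Finset.mem_range.1 hs))

/-- The adjugate formula: adjugate and determinant are continuous, and only the scalar inverse needs
measurability instead of continuity. -/
lemma stronglyMeasurable_designMatrix_inv (hx : ∀ s < t, StronglyMeasurable[m] (x s)) :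
    StronglyMeasurable[m] fun ω => (designMatrix lam (fun s => x s ω) t)⁻¹ := by
  have h := stronglyMeasurable_designMatrix (lam := lam) hx
  have hdet : StronglyMeasurable[m] fun ω => (designMatrix lam (fun s => x s ω) t).det :=
    (continuous_id.matrix_det).comp_stronglyMeasurable h
  have hadj : StronglyMeasurable[m] fun ω => (designMatrix lam (fun s => x s ω) t).adjugate :=
    (continuous_id.matrix_adjugate).comp_stronglyMeasurable h
  simp only [inv_def, Ring.inverse_eq_inv']
  exact hdet.measurable.inv.stronglyMeasurable.smul hadj

lemma stronglyMeasurable_inv_form (hx : ∀ s < t, StronglyMeasurable[m] (x s))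
    {u v : Ω → EuclideanSpace ℝ (Fin d)} (hu : StronglyMeasurable[m] u)
    (hv : StronglyMeasurable[m] v) :
    StronglyMeasurable[m] fun ω =>
      (u ω).ofLp ⬝ᵥ (designMatrix lam (fun s => x s ω) t)⁻¹ *ᵥ (v ω).ofLp := by
  have hc : Continuous fun p : (EuclideanSpace ℝ (Fin d) × EuclideanSpace ℝ (Fin d))
      × Matrix (Fin d) (Fin d) ℝ => p.1.1.ofLp ⬝ᵥ p.2 *ᵥ p.1.2.ofLp := by
    refine Continuous.dotProduct (by fun_prop) (Continuous.matrix_mulVec (by fun_prop) (by fun_prop))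
  exact hc.comp_stronglyMeasurable ((hu.prodMk hv).prodMk (stronglyMeasurable_designMatrix_inv hx))

lemma measurable_weightedNorm (hx : ∀ s < t, StronglyMeasurable[m] (x s))
    {v : Ω → EuclideanSpace ℝ (Fin d)} (hv : StronglyMeasurable[m] v) :
    Measurable[m] fun ω => weightedNorm (designMatrix lam (fun s => x s ω) t)⁻¹ (v ω) :=
  (stronglyMeasurable_inv_form hx hv hv).measurable.sqrt

lemma stronglyMeasurable_noiseSum (hx : ∀ s < t, StronglyMeasurable[m] (x s))
    (hζ : ∀ s < t, StronglyMeasurable[m] (ζ s)) :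
    StronglyMeasurable[m] fun ω => noiseSum (fun s => x s ω) (fun s => ζ s ω) t :=
  Finset.stronglyMeasurable_fun_sum _ fun s hs =>
    (hζ s (Finset.mem_range.1 hs)).smul (hx s (Finset.mem_range.1 hs))

lemma measurable_logDetRatio (hx : ∀ s < t, StronglyMeasurable[m] (x s)) :
    Measurable[m] fun ω => logDetRatio lam (fun s => x s ω) t :=
  (((continuous_id.matrix_det).comp_stronglyMeasurable
    (stronglyMeasurable_designMatrix (lam := lam) hx)).measurable.div_const _).log

lemma measurable_gaussianMixture (hx : ∀ s < t, StronglyMeasurable[m] (x s))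
    (hζ : ∀ s < t, StronglyMeasurable[m] (ζ s)) :
    Measurable[m] fun ω => gaussianMixture lam (fun s => x s ω) (fun s => ζ s ω) t :=
  ((((measurable_weightedNorm hx (stronglyMeasurable_noiseSum hx hζ)).pow_const 2).sub
    (measurable_logDetRatio hx)).div_const 2).exp

end Measurability

variable {Ω : Type*} {mΩ : MeasurableSpace Ω} {P : Measure Ω} [IsProbabilityMeasure P]
  {ℱ : Filtration ℕ mΩ} {x : ℕ → Ω → EuclideanSpace ℝ (Fin d)} {T : ℕ}

/-- The supermartingale property in integrated form: the factor `√(1 + b)` gained in the one-step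
bound cancels the growth of the determinant. -/
lemma lintegral_gaussianMixture_le_one {ζ : ℕ → Ω → ℝ} (hlam : 0 < lam)
    (hx : ∀ t < T, StronglyMeasurable[ℱ t] (x t))
    (hζ : ∀ t < T, StronglyMeasurable[ℱ (t + 1)] (ζ t))
    (hsub : ∀ t < T, IsCondSubGaussian (ℱ t) P (ζ t) 1) {t : ℕ} (ht : t ≤ T) :
    ∫⁻ ω, ENNReal.ofReal (gaussianMixture lam (fun s => x s ω) (fun s => ζ s ω) t) ∂P ≤ 1 := by
  induction t with
  | zero => simp [gaussianMixture_zero hlam]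
  | succ t ih =>
    have htT : t < T := ht
    have hx' : ∀ s < t, StronglyMeasurable[ℱ t] (x s) := fun s hs =>
      (hx s (hs.trans htT)).mono (ℱ.mono hs.le)
    -- The noise of round `s` is known at time `s + 1`, hence at time `t` as `s + 1 ≤ t`.
    have hζ' : ∀ s < t, StronglyMeasurable[ℱ t] (ζ s) := fun s hs =>
      (hζ s (hs.trans htT)).mono (ℱ.mono hs)
    set a : Ω → ℝ := fun ω => (x t ω).ofLp ⬝ᵥ (designMatrix lam (fun s => x s ω) t)⁻¹
      *ᵥ (noiseSum (fun s => x s ω) (fun s => ζ s ω) t).ofLp with ha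
    set b : Ω → ℝ := fun ω => weightedNorm (designMatrix lam (fun s => x s ω) t)⁻¹ (x t ω) ^ 2
      with hb
    set M : Ω → ℝ := fun ω => gaussianMixture lam (fun s => x s ω) (fun s => ζ s ω) t with hM
    have ham : Measurable[ℱ t] a :=
      (stronglyMeasurable_inv_form hx' (hx t htT) (stronglyMeasurable_noiseSum hx' hζ')).measurable
    have hbm : Measurable[ℱ t] b := (measurable_weightedNorm hx' (hx t htT)).pow_const 2
    have hMm : Measurable[ℱ t] M := measurable_gaussianMixture hx' hζ'
    have hM0 : ∀ ω, 0 < M ω := fun ω => Real.exp_pos _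
    have hb0 : ∀ ω, 0 ≤ b ω := fun ω => sq_nonneg _
    refine le_trans ?_ (ih htT.le)
    calc ∫⁻ ω, ENNReal.ofReal (gaussianMixture lam (fun s => x s ω) (fun s => ζ s ω) (t + 1)) ∂P
        = ∫⁻ ω, ENNReal.ofReal (M ω / √(1 + b ω)) * ENNReal.ofReal (Real.exp
            ((2 * ζ t ω * a ω + ζ t ω ^ 2 * b ω - a ω ^ 2) / (2 * (1 + b ω)))) ∂P := by
          refine lintegral_congr fun ω => ?_
          rw [gaussianMixture_succ hlam _ _ t rfl rfl,
            ENNReal.ofReal_mul (div_nonneg (hM0 ω).le (Real.sqrt_nonneg _))]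
      _ ≤ ∫⁻ ω, ENNReal.ofReal (M ω / √(1 + b ω)) * ENNReal.ofReal (√(1 + b ω)) ∂P :=
          (hsub t htT).lintegral_mixture_le ((hζ t htT).measurable.mono (ℱ.le _) le_rfl) (ℱ.le t)
            ham hbm hb0 (hMm.div (hbm.const_add 1).sqrt).ennreal_ofReal
      _ = ∫⁻ ω, ENNReal.ofReal (M ω) ∂P := by
          refine lintegral_congr fun ω => ?_
          have : 0 < √(1 + b ω) := Real.sqrt_pos.2 (by linarith [hb0 ω])
          rw [← ENNReal.ofReal_mul (div_nonneg (hM0 ω).le this.le), div_mul_cancel₀ _ this.ne']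

/-- The self-normalised bound on the noise, before passing to probabilities. -/
lemma exists_sq_weightedNorm_noiseSum_le {η : ℕ → Ω → ℝ} {R : ℝ} (hlam : 0 < lam)
    (hx : ∀ t < T, StronglyMeasurable[ℱ t] (x t))
    (hη : ∀ t < T, StronglyMeasurable[ℱ (t + 1)] (η t))
    (hsub : ∀ t < T, IsCondSubGaussian (ℱ t) P (η t) R) {t : ℕ} (ht : t ≤ T) :
    ∃ M : Ω → ℝ, Measurable M ∧ (∀ ω, 0 < M ω) ∧ Integrable M P ∧ ∫ ω, M ω ∂P ≤ 1 ∧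
      ∀ᵐ ω ∂P, weightedNorm (designMatrix lam (fun s => x s ω) t)⁻¹
          (noiseSum (fun s => x s ω) (fun s => η s ω) t) ^ 2
        ≤ R ^ 2 * (2 * Real.log (M ω) + logDetRatio lam (fun s => x s ω) t) := by
  -- The noise is to be divided by `R`; for `R = 0` it vanishes almost surely and both sides are 0.
  rcases eq_or_ne R 0 with rfl | hR
  · refine ⟨fun _ => 1, measurable_const, fun _ => one_pos, integrable_const _, by simp, ?_⟩
    have h0 : ∀ᵐ ω ∂P, ∀ s < t, η s ω = 0 :=
      ae_all_iff.2 fun s => ae_all_iff.2 fun hs => (hsub s (hs.trans_le ht)).ae_eq_zero (ℱ.le s)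
    filter_upwards [h0] with ω hω
    have : noiseSum (fun s => x s ω) (fun s => η s ω) t = 0 :=
      Finset.sum_eq_zero fun s hs => by simp [hω s (Finset.mem_range.1 hs)]
    simp [this, weightedNorm]
  · set ζ : ℕ → Ω → ℝ := fun s ω => η s ω / R with hζ
    have hζm : ∀ s < T, StronglyMeasurable[ℱ (s + 1)] (ζ s) := fun s hs =>
      ((hη s hs).measurable.div_const R).stronglyMeasurable
    set M : Ω → ℝ := fun ω => gaussianMixture lam (fun s => x s ω) (fun s => ζ s ω) t with hM
    have hMm : Measurable M := measurable_gaussianMixture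
      (fun s hs => (hx s (hs.trans_le ht)).mono (ℱ.le _))
      (fun s hs => (hζm s (hs.trans_le ht)).mono (ℱ.le _))
    have hM0 : ∀ ω, 0 < M ω := fun ω => Real.exp_pos _
    have hle := lintegral_gaussianMixture_le_one hlam hx hζm
      (fun s hs => (hsub s hs).div hR) ht
    have hint : Integrable M P := by
      refine ⟨hMm.aestronglyMeasurable, ?_⟩
      rw [hasFiniteIntegral_iff_ofReal (ae_of_all _ fun ω => (hM0 ω).le)]
      exact hle.trans_lt ENNReal.one_lt_top
    refine ⟨M, hMm, hM0, hint, ?_, ae_of_all _ fun ω => le_of_eq ?_⟩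
    · rw [integral_eq_lintegral_of_nonneg_ae (ae_of_all _ fun ω => (hM0 ω).le)
        hMm.aestronglyMeasurable]
      exact ENNReal.toReal_le_of_le_ofReal zero_le_one (by simpa using hle)
    · have hS : noiseSum (fun s => x s ω) (fun s => η s ω) t
          = R • noiseSum (fun s => x s ω) (fun s => ζ s ω) t := by
        rw [noiseSum, noiseSum, Finset.smul_sum]
        refine Finset.sum_congr rfl fun s _ => ?_
        rw [smul_smul, hζ, mul_div_cancel₀ _ hR]
      have hp := (posDef_designMatrix hlam (fun s => x s ω) t).inv.posSemidef
      simp only [hM, gaussianMixture]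
      rw [Real.log_exp, sq_weightedNorm hp, sq_weightedNorm hp, hS,
        WithLp.ofLp_smul, mulVec_smul, dotProduct_smul, smul_dotProduct, smul_eq_mul, smul_eq_mul]
      ring

end SelfNormalized

/-! ### Estimation error, optimism and the regret on a single task. -/

section Regret

open Matrix

variable {d : ℕ} {lam : ℝ}

/-- Since `y_s - x_sᵀ h = x_sᵀ (w - h) + η_s`, the sum in the estimate is `(V_t - lam I) (w - h)`
plus the noise sum. -/
lemma biasedEstimate_eq (hlam : 0 < lam) (h w : EuclideanSpace ℝ (Fin d))
    (x : ℕ → EuclideanSpace ℝ (Fin d)) (η : ℕ → ℝ) (t : ℕ) :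
    biasedEstimate lam h x (fun s => inner ℝ (x s) w + η s) t
      = w + WithLp.toLp 2 ((designMatrix lam x t)⁻¹
          *ᵥ (lam • (h - w) + noiseSum x η t).ofLp) := by
  have hV := (isUnit_iff_isUnit_det _).1 (posDef_designMatrix hlam x t).isUnit
  have hG : ∀ u : Fin d → ℝ, designMatrix lam x t *ᵥ u
      = lam • u + ∑ s ∈ Finset.range t, ((x s).ofLp ⬝ᵥ u) • (x s).ofLp := by
    intro u
    rw [designMatrix, add_mulVec, smul_mulVec, one_mulVec, sum_mulVec]
    congr 1
    refine Finset.sum_congr rfl fun s _ => ?_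
    rw [vecMulVec_mulVec]
    ext i
    simp [mul_comm]
  have hsum : ∑ s ∈ Finset.range t, ((inner ℝ (x s) w + η s) - inner ℝ (x s) h) • (x s).ofLp
      = designMatrix lam x t *ᵥ (w.ofLp - h.ofLp) + (lam • (h - w) + noiseSum x η t).ofLp := by
    rw [hG, WithLp.ofLp_add, WithLp.ofLp_smul, WithLp.ofLp_sub, noiseSum, WithLp.ofLp_sum]
    have : ∀ s, ((inner ℝ (x s) w + η s) - inner ℝ (x s) h) • (x s).ofLp
        = ((x s).ofLp ⬝ᵥ (w.ofLp - h.ofLp)) • (x s).ofLp + (η s • x s).ofLp := by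
      intro s
      rw [inner_eq_dotProduct_ofLp, inner_eq_dotProduct_ofLp, dotProduct_sub, WithLp.ofLp_smul,
        ← add_smul]
      congr 1
      ring
    rw [Finset.sum_congr rfl fun s _ => this s, Finset.sum_add_distrib]
    module
  rw [biasedEstimate, hsum, mulVec_add, mulVec_mulVec, nonsing_inv_mul _ hV, one_mulVec,
    WithLp.toLp_add, WithLp.toLp_sub, WithLp.toLp_ofLp, WithLp.toLp_ofLp]
  abel

lemma abs_inner_biasedEstimate_sub_le (hlam : 0 < lam) (h w v : EuclideanSpace ℝ (Fin d))
    (x : ℕ → EuclideanSpace ℝ (Fin d)) (η : ℕ → ℝ) (t : ℕ) :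
    |inner ℝ v (biasedEstimate lam h x (fun s => inner ℝ (x s) w + η s) t) - inner ℝ v w|
      ≤ weightedNorm (designMatrix lam x t)⁻¹ v
        * (√lam * ‖h - w‖ + weightedNorm (designMatrix lam x t)⁻¹ (noiseSum x η t)) := by
  have hp := (posDef_designMatrix hlam x t).inv.posSemidef
  rw [biasedEstimate_eq hlam, inner_add_right, add_sub_cancel_left, inner_eq_dotProduct_ofLp,
    WithLp.ofLp_add, mulVec_add, dotProduct_add, WithLp.ofLp_smul, mulVec_smul, dotProduct_smul,
    smul_eq_mul, mul_add]
  refine (abs_add_le _ _).trans (add_le_add ?_ (abs_form_le_weightedNorm_mul hp _ _))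
  rw [abs_mul, abs_of_pos hlam]
  calc lam * |v.ofLp ⬝ᵥ (designMatrix lam x t)⁻¹ *ᵥ (h - w).ofLp|
      ≤ lam * (weightedNorm (designMatrix lam x t)⁻¹ v * (‖h - w‖ / √lam)) := by
        refine mul_le_mul_of_nonneg_left ((abs_form_le_weightedNorm_mul hp _ _).trans ?_) hlam.le
        exact mul_le_mul_of_nonneg_left (weightedNorm_inv_designMatrix_le hlam x t _)
          (weightedNorm_nonneg _ _)
    _ = _ := by
        have hs : 0 < √lam := Real.sqrt_pos.2 hlam
        nth_rewrite 1 [← Real.mul_self_sqrt hlam.le]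
        field_simp

lemma confidenceRadius_one_div (hlam : 0 < lam) {T : ℕ} (hT : 0 < T) (R : ℝ)
    (h w : EuclideanSpace ℝ (Fin d)) (x : ℕ → EuclideanSpace ℝ (Fin d)) (t : ℕ) :
    confidenceRadius R lam (1 / (T : ℝ)) h w x t
      = √lam * ‖h - w‖ + R * √(2 * Real.log T + logDetRatio lam x t) := by
  have h1 := det_smul_one_pos (d := d) hlam
  have h2 := (posDef_designMatrix hlam x t).det_pos
  have hT' : (0 : ℝ) < T := by exact_mod_cast hT
  have h3 : √(designMatrix lam x t).det / (√(lam • (1 : Matrix (Fin d) (Fin d) ℝ)).det * (1 / T))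
      = T * √((designMatrix lam x t).det / (lam • (1 : Matrix (Fin d) (Fin d) ℝ)).det) := by
    rw [Real.sqrt_div h2.le]
    field_simp
  rw [confidenceRadius, h3, Real.log_mul hT'.ne' (Real.sqrt_pos.2 (div_pos h2 h1)).ne',
    Real.log_sqrt (div_pos h2 h1).le, ← logDetRatio]
  ring_nf

/-- The regret of one round of BIAS-OFUL, in terms of the size of the noise. -/
lemma inner_sub_le_of_optimistic (hlam : 0 < lam) {T : ℕ} (hT : 0 < T) {R : ℝ}
    {h w u v : EuclideanSpace ℝ (Fin d)} {x : ℕ → EuclideanSpace ℝ (Fin d)} {η : ℕ → ℝ} {t : ℕ}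
    (huv : optimisticValue R lam (1 / (T : ℝ)) h w x (fun s => inner ℝ (x s) w + η s) t u
      ≤ optimisticValue R lam (1 / (T : ℝ)) h w x (fun s => inner ℝ (x s) w + η s) t v) :
    inner ℝ (u - v) w
      ≤ weightedNorm (designMatrix lam x t)⁻¹ u
          * (weightedNorm (designMatrix lam x t)⁻¹ (noiseSum x η t)
            - R * √(2 * Real.log T + logDetRatio lam x t))
        + weightedNorm (designMatrix lam x t)⁻¹ v
          * (2 * (√lam * ‖h - w‖) + weightedNorm (designMatrix lam x t)⁻¹ (noiseSum x η t)
            + R * √(2 * Real.log T + logDetRatio lam x t)) := by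
  have h1 := (abs_le.1 (abs_inner_biasedEstimate_sub_le hlam h w u x η t)).1
  have h2 := (abs_le.1 (abs_inner_biasedEstimate_sub_le hlam h w v x η t)).2
  rw [optimisticValue, optimisticValue, confidenceRadius_one_div hlam hT] at huv
  rw [inner_sub_left]
  linarith

variable {Ω : Type*} {mΩ : MeasurableSpace Ω} {P : Measure Ω} {ℱ : Filtration ℕ mΩ} {T : ℕ}
  {R L : ℝ} {h w : EuclideanSpace ℝ (Fin d)}
  {D : ℕ → Ω → Set (EuclideanSpace ℝ (Fin d))} {x xs : ℕ → Ω → EuclideanSpace ℝ (Fin d)}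
  {η : ℕ → Ω → ℝ}

lemma IsLinearBandit.nonneg [IsProbabilityMeasure P] (hb : IsLinearBandit T R L w P ℱ D x η)
    (hT : 0 < T) : 0 ≤ L := by
  obtain ⟨ω, h1, h2⟩ := ((hb.arm_mem 0 hT).and (hb.norm_le 0 hT)).exists
  exact (norm_nonneg _).trans (h2 _ h1)

/-- Nonnegativity lets `integral_mono_of_nonneg` bound the expected regret without integrability of
the regret. -/
lemma IsLinearBandit.pseudoRegret_nonneg (hb : IsLinearBandit T R L w P ℱ D x η)
    (ho : IsOptimalPolicy T w P D xs) : ∀ᵐ ω ∂P, 0 ≤ pseudoRegret T w xs x ω := by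
  have h1 : ∀ᵐ ω ∂P, ∀ t < T, x t ω ∈ D t ω :=
    ae_all_iff.2 fun t => ae_all_iff.2 fun ht => hb.arm_mem t ht
  have h2 : ∀ᵐ ω ∂P, ∀ t < T, xs t ω ∈ D t ω ∧ IsMaxOn (fun v => inner ℝ v w) (D t ω) (xs t ω) :=
    ae_all_iff.2 fun t => ae_all_iff.2 fun ht => ho t ht
  filter_upwards [h1, h2] with ω h1 h2
  refine Finset.sum_nonneg fun t ht => ?_
  have ht' := Finset.mem_range.1 ht
  rw [inner_sub_left, sub_nonneg]
  exact isMaxOn_iff.1 (h2 t ht').2 _ (h1 t ht')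

/-- The data of a run of BIAS-OFUL that hold simultaneously on almost every path. -/
lemma IsLinearBandit.ae_regret_le (hlam : 0 < lam) (hT : 0 < T) [NeZero d]
    (hb : IsLinearBandit T R L w P ℱ D x η)
    (hp : IsBiasOFUL T R lam (1 / (T : ℝ)) h w P D x η) (ho : IsOptimalPolicy T w P D xs) :
    ∀ᵐ ω ∂P,
      (∀ t ≤ T, logDetRatio lam (fun s => x s ω) t ≤ d * Real.log (1 + T * L ^ 2 / (lam * d))) ∧
      ∀ t < T, ‖x t ω‖ ≤ L ∧ ‖xs t ω‖ ≤ L ∧ inner ℝ (xs t ω - x t ω) w ≤ (2 : ℝ) ∧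
        inner ℝ (xs t ω - x t ω) w
          ≤ weightedNorm (designMatrix lam (fun s => x s ω) t)⁻¹ (xs t ω)
            * (weightedNorm (designMatrix lam (fun s => x s ω) t)⁻¹
                (noiseSum (fun s => x s ω) (fun s => η s ω) t)
              - R * √(2 * Real.log T + logDetRatio lam (fun s => x s ω) t))
          + weightedNorm (designMatrix lam (fun s => x s ω) t)⁻¹ (x t ω)
            * (2 * (√lam * ‖h - w‖) + weightedNorm (designMatrix lam (fun s => x s ω) t)⁻¹
                (noiseSum (fun s => x s ω) (fun s => η s ω) t)
              + R * √(2 * Real.log T + logDetRatio lam (fun s => x s ω) t)) := by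
  have hall : ∀ {p : ℕ → Ω → Prop}, (∀ t < T, ∀ᵐ ω ∂P, p t ω) → ∀ᵐ ω ∂P, ∀ t < T, p t ω :=
    fun hp => ae_all_iff.2 fun t => ae_all_iff.2 fun ht => hp t ht
  filter_upwards [hall hb.arm_mem, hall hb.norm_le, hall hb.mean_mem, hall hp, hall ho]
    with ω hmem hnorm hmean hopt hbest
  refine ⟨fun t ht => logDetRatio_le hlam ht fun s hs => ?_, fun t ht => ?_⟩
  · exact hnorm s (hs.trans_le ht) _ (hmem s (hs.trans_le ht))
  · refine ⟨hnorm t ht _ (hmem t ht), hnorm t ht _ (hbest t ht).1, ?_, ?_⟩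
    · rw [inner_sub_left]
      linarith [(hmean t ht _ (hbest t ht).1).2, (hmean t ht _ (hmem t ht)).1]
    · exact inner_sub_le_of_optimistic hlam hT (isMaxOn_iff.1 (hopt t ht) _ (hbest t ht).1)

/-- As `d ≥ 1`, both logarithms fit into `2 * d * (log T + log (1 + z))`. -/
lemma sqrt_two_mul_log_add_le {ℓ : ℝ} (hT : 0 < T) (hd : 0 < d) {z : ℝ} (hz : 0 ≤ z)
    (hℓ : ℓ ≤ d * Real.log (1 + z)) :
    √(2 * Real.log T + ℓ) ≤ √2 * √(d * Real.log (T + T * z)) := by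
  have hT1 : (1 : ℝ) ≤ T := by exact_mod_cast hT
  have hd1 : (1 : ℝ) ≤ d := by exact_mod_cast hd
  rw [← Real.sqrt_mul zero_le_two]
  refine Real.sqrt_le_sqrt ?_
  rw [show (T : ℝ) + T * z = T * (1 + z) by ring, Real.log_mul (by positivity) (by positivity)]
  have h1 := Real.log_nonneg hT1
  have h2 := mul_nonneg (Nat.cast_nonneg (α := ℝ) d) (Real.log_nonneg (by linarith : 1 ≤ 1 + z))
  nlinarith [mul_nonneg (sub_nonneg.2 hd1) h1]

/-- The expected regret of BIAS-OFUL on one task. -/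
lemma IsLinearBandit.integral_pseudoRegret_le [IsProbabilityMeasure P] (hlam : 0 < lam)
    (hT : 0 < T) (hR : 0 ≤ R) [NeZero d] (hb : IsLinearBandit T R L w P ℱ D x η)
    (hp : IsBiasOFUL T R lam (1 / (T : ℝ)) h w P D x η) (ho : IsOptimalPolicy T w P D xs) {z : ℝ}
    (hz : z = T * L ^ 2 / (lam * d)) :
    ∫ ω, pseudoRegret T w xs x ω ∂P
      ≤ 2 + 2 * (1 + (√lam * ‖h - w‖ + R * (√2 * √(d * Real.log (T + T * z)))))
          * √(2 * T * (d * Real.log (1 + z))) := by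
  have hd : 0 < d := Nat.pos_of_ne_zero (NeZero.ne d)
  have hT0 : (0 : ℝ) < T := by exact_mod_cast hT
  have hz0 : 0 ≤ z := by rw [hz]; positivity
  choose M hMm hM0 hMi hM1 hMle using fun t : Fin T =>
    exists_sq_weightedNorm_noiseSum_le hlam hb.arm_measurable hb.noise_measurable
      hb.noise_subGaussian t.2.le
  set B := √lam * ‖h - w‖ + R * (√2 * √(d * Real.log (T + T * z))) with hB
  have hB0 : 0 ≤ B := by positivity
  -- The bad event of round `t`. The threshold `T` matches the confidence level `1 / T`, and `E M ≤
  -- 1` gives it probability at most `1 / T`.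
  set G : Fin T → Set Ω := fun t => {ω | (T : ℝ) ≤ M t ω} with hG
  have hGm : ∀ t, MeasurableSet (G t) := fun t => measurableSet_le measurable_const (hMm t)
  have hGP : ∀ t, P.real (G t) ≤ 1 / T := fun t => by
    rw [le_div_iff₀' hT0]
    exact (mul_meas_ge_le_integral_of_nonneg (ae_of_all _ fun ω => (hM0 t ω).le) (hMi t) T).trans
      (hM1 t)
  have hGi : ∀ t, Integrable ((G t).indicator fun _ => (2 : ℝ)) P := fun t =>
    (integrable_const _).indicator (hGm t)
  have hpt : ∀ᵐ ω ∂P, pseudoRegret T w xs x ω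
      ≤ ∑ t : Fin T, (G t).indicator (fun _ => (2 : ℝ)) ω
        + 2 * (1 + B) * √(2 * T * (d * Real.log (1 + z))) := by
    filter_upwards [hb.ae_regret_le hlam hT hp ho, ae_all_iff.2 hMle] with ω hω hN
    obtain ⟨hdet, hreg⟩ := hω
    rw [← hz] at hdet
    have hsum := sum_min_one_weightedNorm_le hlam (fun s => x s ω) T
    have hsum' : ∑ t ∈ Finset.range T,
        min 1 (weightedNorm (designMatrix lam (fun s => x s ω) t)⁻¹ (x t ω))
        ≤ √(2 * T * (d * Real.log (1 + z))) :=
      hsum.trans (Real.sqrt_le_sqrt (mul_le_mul_of_nonneg_left (hdet T le_rfl) (by positivity)))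
    rw [pseudoRegret, ← Fin.sum_univ_eq_sum_range (fun t => inner ℝ (xs t ω - x t ω) w)]
    rw [← Fin.sum_univ_eq_sum_range
      (fun t => min 1 (weightedNorm (designMatrix lam (fun s => x s ω) t)⁻¹ (x t ω)))] at hsum'
    refine le_trans ?_ (add_le_add_right (mul_le_mul_of_nonneg_left hsum' (by positivity)) _)
    rw [Finset.mul_sum, ← Finset.sum_add_distrib]
    refine Finset.sum_le_sum fun t _ => ?_
    obtain ⟨-, -, h2, hr⟩ := hreg t t.2
    have hNt := hN t
    have hn0 := weightedNorm_nonneg (designMatrix lam (fun s => x s ω) t)⁻¹ (x t ω)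
    have hns0 := weightedNorm_nonneg (designMatrix lam (fun s => x s ω) t)⁻¹ (xs t ω)
    have hN0 := weightedNorm_nonneg (designMatrix lam (fun s => x s ω) t)⁻¹
      (noiseSum (fun s => x s ω) (fun s => η s ω) t)
    have hc : √(2 * Real.log T + logDetRatio lam (fun s => x s ω) t)
        ≤ √2 * √(d * Real.log (T + T * z)) :=
      sqrt_two_mul_log_add_le hT hd hz0 (hdet t t.2.le)
    have hrad : 0 ≤ 2 * Real.log T + logDetRatio lam (fun s => x s ω) t :=
      add_nonneg (mul_nonneg zero_le_two (Real.log_natCast_nonneg T)) (logDetRatio_nonneg hlam _ _)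
    have hsq := Real.sq_sqrt hrad
    have hc0 := Real.sqrt_nonneg (2 * Real.log T + logDetRatio lam (fun s => x s ω) t)
    set n := weightedNorm (designMatrix lam (fun s => x s ω) t)⁻¹ (x t ω)
    set ns := weightedNorm (designMatrix lam (fun s => x s ω) t)⁻¹ (xs t ω)
    set N := weightedNorm (designMatrix lam (fun s => x s ω) t)⁻¹
      (noiseSum (fun s => x s ω) (fun s => η s ω) t)
    set c := √(2 * Real.log T + logDetRatio lam (fun s => x s ω) t)
    have hmin : 0 ≤ min 1 n := le_min zero_le_one hn0
    by_cases hω : ω ∈ G t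
    · rw [Set.indicator_of_mem hω]
      have : 0 ≤ 2 * (1 + B) * min 1 n := by positivity
      linarith
    · rw [Set.indicator_of_notMem hω, zero_add]
      have hMT : M t ω ≤ T := (not_le.1 hω).le
      -- Off the bad event `log (M t ω) ≤ log T`, which turns the self-normalised bound into `R²
      -- c²`.
      have hNc : N ≤ R * c := by
        refine le_of_sq_le_sq ?_ (mul_nonneg hR hc0)
        rw [mul_pow, hsq]
        refine hNt.trans (mul_le_mul_of_nonneg_left ?_ (sq_nonneg R))
        linarith [Real.log_le_log (hM0 t ω) hMT]
      have hRc : R * c ≤ R * (√2 * √(d * Real.log (T + T * z))) := mul_le_mul_of_nonneg_left hc hR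
      have hrB : inner ℝ (xs t ω - x t ω) w ≤ n * (2 * B) := by
        refine hr.trans ?_
        have h3 : ns * (N - R * c) ≤ 0 := mul_nonpos_of_nonneg_of_nonpos hns0 (by linarith)
        have h4 : n * (2 * (√lam * ‖h - w‖) + N + R * c) ≤ n * (2 * B) :=
          mul_le_mul_of_nonneg_left (by rw [hB]; linarith) hn0
        linarith
      -- The regret is at most 2 and at most `2 * B * n`; the factor `1 + B` covers both regimes of
      -- the truncated width.
      rcases le_total 1 n with hn | hn
      · rw [min_eq_left hn]; linarith
      · rw [min_eq_right hn]; nlinarith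
  calc ∫ ω, pseudoRegret T w xs x ω ∂P
      ≤ ∫ ω, (∑ t : Fin T, (G t).indicator (fun _ => (2 : ℝ)) ω
        + 2 * (1 + B) * √(2 * T * (d * Real.log (1 + z)))) ∂P :=
        integral_mono_of_nonneg (hb.pseudoRegret_nonneg ho)
          ((integrable_finsetSum _ fun t _ => hGi t).add (integrable_const _)) hpt
    _ = ∑ t : Fin T, P.real (G t) * 2 + 2 * (1 + B) * √(2 * T * (d * Real.log (1 + z))) := by
        rw [integral_add (integrable_finsetSum _ fun t _ => hGi t) (integrable_const _),
          integral_finsetSum _ fun t _ => hGi t]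
        simp [integral_indicator_const, hGm]
    _ ≤ ∑ t : Fin T, 1 / (T : ℝ) * 2 + 2 * (1 + B) * √(2 * T * (d * Real.log (1 + z))) := by
        gcongr with t
        exact hGP t
    _ = _ := by
        rw [Finset.sum_const, Finset.card_univ, Fintype.card_fin, nsmul_eq_mul]
        field_simp

/-- The expected regret of BIAS-OFUL on one task, when the design matrices stay close to `lam I`. -/
lemma IsLinearBandit.integral_pseudoRegret_le_of_small [IsProbabilityMeasure P] (hlam : 0 < lam)
    (hT : 0 < T) (hR : 0 ≤ R) [NeZero d] (hb : IsLinearBandit T R L w P ℱ D x η)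
    (hp : IsBiasOFUL T R lam (1 / (T : ℝ)) h w P D x η) (ho : IsOptimalPolicy T w P D xs) {z : ℝ}
    (hz : z = T * L ^ 2 / (lam * d)) (hsmall : d * Real.log (1 + z) ≤ 1) :
    ∫ ω, pseudoRegret T w xs x ω ∂P
      ≤ T * (L / √lam * (2 * (√lam * ‖h - w‖) + R * (√2 * √(d * Real.log (T + T * z))) + 2 * R)) := by
  have hd : 0 < d := Nat.pos_of_ne_zero (NeZero.ne d)
  have hz0 : 0 ≤ z := by rw [hz]; positivity
  have hL := hb.nonneg hT
  choose M hMm hM0 hMi hM1 hMle using fun t : Fin T =>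
    exists_sq_weightedNorm_noiseSum_le hlam hb.arm_measurable hb.noise_measurable
      hb.noise_subGaussian t.2.le
  set B := 2 * (√lam * ‖h - w‖) + R * (√2 * √(d * Real.log (T + T * z))) with hB
  have hpt : ∀ᵐ ω ∂P, pseudoRegret T w xs x ω
      ≤ ∑ t : Fin T, L / √lam * (B + 2 * R * M t ω) := by
    filter_upwards [hb.ae_regret_le hlam hT hp ho, ae_all_iff.2 hMle] with ω hω hN
    obtain ⟨hdet, hreg⟩ := hω
    rw [← hz] at hdet
    rw [pseudoRegret, ← Fin.sum_univ_eq_sum_range (fun t => inner ℝ (xs t ω - x t ω) w)]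
    refine Finset.sum_le_sum fun t _ => ?_
    obtain ⟨hx, hxs, -, hr⟩ := hreg t t.2
    have hNt := hN t
    have hle : ∀ v : EuclideanSpace ℝ (Fin d), ‖v‖ ≤ L →
        weightedNorm (designMatrix lam (fun s => x s ω) t)⁻¹ v ≤ L / √lam := fun v hv =>
      (weightedNorm_inv_designMatrix_le hlam _ _ v).trans (by gcongr)
    have hn := hle _ hx
    have hns := hle _ hxs
    have hns0 := weightedNorm_nonneg (designMatrix lam (fun s => x s ω) t)⁻¹ (xs t ω)
    have hN0 := weightedNorm_nonneg (designMatrix lam (fun s => x s ω) t)⁻¹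
      (noiseSum (fun s => x s ω) (fun s => η s ω) t)
    have hc : √(2 * Real.log T + logDetRatio lam (fun s => x s ω) t)
        ≤ √2 * √(d * Real.log (T + T * z)) :=
      sqrt_two_mul_log_add_le hT hd hz0 (hdet t t.2.le)
    have hc0 := Real.sqrt_nonneg (2 * Real.log T + logDetRatio lam (fun s => x s ω) t)
    have hNM : weightedNorm (designMatrix lam (fun s => x s ω) t)⁻¹
        (noiseSum (fun s => x s ω) (fun s => η s ω) t) ≤ R * M t ω := by
      -- Smallness of the log-determinant enters here: `2 log M + 1 ≤ 2 M - 1 ≤ M²`.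
      refine le_of_sq_le_sq ?_ (mul_nonneg hR (hM0 t ω).le)
      rw [mul_pow]
      refine hNt.trans (mul_le_mul_of_nonneg_left ?_ (sq_nonneg R))
      have h1 := Real.log_le_sub_one_of_pos (hM0 t ω)
      have h2 := hdet t t.2.le
      nlinarith [sq_nonneg (M t ω - 1)]
    set n := weightedNorm (designMatrix lam (fun s => x s ω) t)⁻¹ (x t ω)
    set ns := weightedNorm (designMatrix lam (fun s => x s ω) t)⁻¹ (xs t ω)
    set N := weightedNorm (designMatrix lam (fun s => x s ω) t)⁻¹
      (noiseSum (fun s => x s ω) (fun s => η s ω) t)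
    set c := √(2 * Real.log T + logDetRatio lam (fun s => x s ω) t)
    have hRc : R * c ≤ R * (√2 * √(d * Real.log (T + T * z))) := mul_le_mul_of_nonneg_left hc hR
    have hRc0 : 0 ≤ R * c := mul_nonneg hR hc0
    refine hr.trans ?_
    -- No good event is available to make this term nonpositive; it is bounded by dropping `-R * c`.
    have h3 : ns * (N - R * c) ≤ L / √lam * (R * M t ω) :=
      (mul_le_mul_of_nonneg_left (by linarith) hns0).trans
        (mul_le_mul_of_nonneg_right hns (mul_nonneg hR (hM0 t ω).le))
    have h4 : n * (2 * (√lam * ‖h - w‖) + N + R * c) ≤ L / √lam * (B + R * M t ω) :=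
      (mul_le_mul_of_nonneg_right hn (by positivity)).trans
        (mul_le_mul_of_nonneg_left (by rw [hB]; linarith) (by positivity))
    linarith
  have hi : ∀ t, Integrable (fun ω => L / √lam * (B + 2 * R * M t ω)) P := fun t =>
    ((integrable_const _).add ((hMi t).const_mul _)).const_mul _
  calc ∫ ω, pseudoRegret T w xs x ω ∂P
      ≤ ∫ ω, ∑ t : Fin T, L / √lam * (B + 2 * R * M t ω) ∂P :=
        integral_mono_of_nonneg (hb.pseudoRegret_nonneg ho)
          (integrable_finsetSum _ fun t _ => hi t) hpt
    _ = ∑ t : Fin T, L / √lam * (B + 2 * R * ∫ ω, M t ω ∂P) := by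
        rw [integral_finsetSum _ fun t _ => hi t]
        refine Finset.sum_congr rfl fun t _ => ?_
        rw [integral_const_mul, integral_add (integrable_const _) ((hMi t).const_mul _),
          integral_const_mul]
        simp
    _ ≤ ∑ t : Fin T, L / √lam * (B + 2 * R * 1) := by
        gcongr with t
        exact hM1 t
    _ = _ := by
        rw [Finset.sum_const, Finset.card_univ, Fintype.card_fin, nsmul_eq_mul, mul_one]

end Regret

/-! ### Comparisons for the target bound. -/

section Bound

lemma transferBound_eq (C : ℝ) (T d : ℕ) (Λ V : ℝ) :
    transferBound C T d Λ V
      = (1 + √T * √(d * Real.log (T + T * (Λ * ((T : ℝ) ^ 2 * V / d)))))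
        * (C * √(d * Real.log (1 + Λ * ((T : ℝ) ^ 2 * V / d)))) := by
  rw [transferBound, ← Real.sqrt_mul (Nat.cast_nonneg T),
    show (T : ℝ) ^ 3 * Λ * V / d = T * (Λ * ((T : ℝ) ^ 2 * V / d)) by ring,
    show (T : ℝ) ^ 2 * Λ * V / d = Λ * ((T : ℝ) ^ 2 * V / d) by ring, mul_assoc]

/-- Bernoulli's inequality `1 + κ y ≤ (1 + y) ^ κ`. -/
lemma log_one_add_mul_le {κ y : ℝ} (hκ : 1 ≤ κ) (hy : 0 ≤ y) :
    Real.log (1 + κ * y) ≤ κ * Real.log (1 + y) := by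
  rw [← Real.log_rpow (by linarith)]
  exact Real.log_le_log (by positivity)
    (one_add_mul_self_le_rpow_one_add (by linarith) hκ)

/-- Replacing `L²` by `κ L` with `κ = max 1 L` costs `√κ` in each of the two square roots, so `κ` in
the product. -/
lemma transferBound_sq_le {C L V : ℝ} {T d : ℕ} (hT : 0 < T) (hC : 0 ≤ C) (hL : 0 ≤ L)
    (hV : 0 ≤ V) : transferBound C T d (L ^ 2) V ≤ transferBound (C * max 1 L) T d L V := by
  have hT1 : (1 : ℝ) ≤ T := by exact_mod_cast hT
  set κ := max 1 L with hκ
  have hκ1 : 1 ≤ κ := le_max_left _ _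
  set u := (T : ℝ) ^ 2 * V / d with hu
  have hu0 : 0 ≤ u := by positivity
  have hlog : Real.log (1 + L ^ 2 * u) ≤ κ * Real.log (1 + L * u) := by
    refine le_trans (Real.log_le_log (by positivity) ?_) (log_one_add_mul_le hκ1 (by positivity))
    have : L * (L * u) ≤ κ * (L * u) :=
      mul_le_mul_of_nonneg_right (le_max_right _ _) (by positivity)
    linarith
  have hlogT : Real.log (T + T * (L ^ 2 * u)) ≤ κ * Real.log (T + T * (L * u)) := by
    have h : ∀ y : ℝ, 0 ≤ y → Real.log (T + T * y) = Real.log T + Real.log (1 + y) := by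
      intro y hy
      rw [← Real.log_mul (by positivity) (by positivity), mul_add, mul_one]
    rw [h _ (by positivity), h _ (by positivity), mul_add]
    nlinarith [Real.log_nonneg hT1]
  have hκs : 1 ≤ √κ := Real.one_le_sqrt.2 hκ1
  have h1 : √(d * Real.log (1 + L ^ 2 * u)) ≤ √κ * √(d * Real.log (1 + L * u)) := by
    rw [← Real.sqrt_mul (by positivity)]
    refine Real.sqrt_le_sqrt ?_
    calc (d : ℝ) * Real.log (1 + L ^ 2 * u) ≤ d * (κ * Real.log (1 + L * u)) := by gcongr
      _ = _ := by ring
  have h2 : √(d * Real.log (T + T * (L ^ 2 * u))) ≤ √κ * √(d * Real.log (T + T * (L * u))) := by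
    rw [← Real.sqrt_mul (by positivity)]
    refine Real.sqrt_le_sqrt ?_
    calc (d : ℝ) * Real.log (T + T * (L ^ 2 * u)) ≤ d * (κ * Real.log (T + T * (L * u))) := by gcongr
      _ = _ := by ring
  rw [transferBound_eq, transferBound_eq, ← hu]
  calc (1 + √T * √(d * Real.log (T + T * (L ^ 2 * u)))) * (C * √(d * Real.log (1 + L ^ 2 * u)))
      ≤ (√κ * 1 + √T * (√κ * √(d * Real.log (T + T * (L * u)))))
          * (C * (√κ * √(d * Real.log (1 + L * u)))) := by
        gcongr
        linarith
    _ = (√κ * √κ) * ((1 + √T * √(d * Real.log (T + T * (L * u))))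
          * (C * √(d * Real.log (1 + L * u)))) := by ring
    _ = _ := by rw [Real.mul_self_sqrt (by positivity)]; ring

/-- At `V = 0` the logarithms have nonzero arguments `T` and 1, so the bound is continuous there,
and the second logarithm is 0. -/
lemma tendsto_transferBound (C L : ℝ) {d T : ℕ} (hT : 0 < T) :
    Tendsto (fun V : ℝ => transferBound C T d L V) (𝓝[>] 0) (𝓝 0) := by
  have hT0 : (T : ℝ) ≠ 0 := by exact_mod_cast hT.ne'
  have h : ContinuousAt (fun V : ℝ => transferBound C T d L V) 0 := by
    unfold transferBound
    refine ContinuousAt.mul (continuousAt_const.add (ContinuousAt.sqrt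
      (continuousAt_const.mul (ContinuousAt.log (by fun_prop) (by simpa using hT0)))))
      (continuousAt_const.mul (ContinuousAt.sqrt
        (continuousAt_const.mul (ContinuousAt.log (by fun_prop) (by simp)))))
  have h0 : transferBound C T d L 0 = 0 := by simp [transferBound]
  have := h.tendsto
  rw [h0] at this
  exact this.mono_left nhdsWithin_le_nhds

/-- For `T ≥ 2` this uses `log 2 ≥ 1 / 4`; for `T = 1` the logarithm may vanish and the summand 1 is
needed. -/
lemma sqrt_natCast_le {T d : ℕ} (hT : 0 < T) (hd : 0 < d) {z : ℝ} (hz : 0 ≤ z) :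
    √T ≤ 2 * (1 + √T * √(d * Real.log (T + T * z))) := by
  have hd1 : (1 : ℝ) ≤ d := by exact_mod_cast hd
  rcases Nat.lt_or_ge T 2 with h | h
  · obtain rfl : T = 1 := by omega
    rw [Nat.cast_one, Real.sqrt_one, one_mul]
    linarith [Real.sqrt_nonneg (d * Real.log (1 + 1 * z))]
  · have h2 : (2 : ℝ) ≤ T := by exact_mod_cast h
    have hlog : (1 / 2 : ℝ) ^ 2 ≤ d * Real.log (T + T * z) := by
      have h3 : Real.log 2 ≤ Real.log (T + T * z) :=
        Real.log_le_log two_pos (by nlinarith)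
      nlinarith [Real.log_two_gt_d9]
    have := mul_le_mul_of_nonneg_left (Real.le_sqrt_of_sq_le hlog) (Real.sqrt_nonneg T)
    linarith

end Bound

/-! ### Averaging over the tasks. -/

section Transfer

variable {d T : ℕ} {R L lam : ℝ} {h : EuclideanSpace ℝ (Fin d)}
  {ρ : Measure (EuclideanSpace ℝ (Fin d))} [IsProbabilityMeasure ρ]

lemma integrable_norm_sub_sq {S : ℝ} (hS : ∀ᵐ w ∂ρ, ‖w‖ ≤ S) (h : EuclideanSpace ℝ (Fin d)) :
    Integrable (fun w => ‖w - h‖ ^ 2) ρ := by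
  refine Integrable.of_bound (C := (S + ‖h‖) ^ 2) (by fun_prop) ?_
  filter_upwards [hS] with w hw
  rw [norm_pow, norm_norm]
  exact pow_le_pow_left₀ (norm_nonneg _) ((norm_sub_le _ _).trans (by linarith)) 2

/-- The weighted inequality `‖w - h‖ ≤ √V / 2 + ‖w - h‖² / (2 √V)` integrates to exactly `√V`, so it
serves in place of Jensen's inequality. No measurability of `f` is required. -/
lemma integral_affine_norm_sub_le {S : ℝ} (hS : ∀ᵐ w ∂ρ, ‖w‖ ≤ S) (hV : 0 < taskVar ρ h)
    {f : EuclideanSpace ℝ (Fin d) → ℝ} (hf : 0 ≤ᵐ[ρ] f) {α γ : ℝ} (hγ : 0 ≤ γ)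
    (hle : ∀ᵐ w ∂ρ, f w ≤ α + γ * ‖h - w‖) :
    ∫ w, f w ∂ρ ≤ α + γ * √(taskVar ρ h) := by
  set V := taskVar ρ h with hVdef
  have hs : 0 < √V := Real.sqrt_pos.2 hV
  have hi : Integrable (fun w => α + γ / 2 * √V + γ / (2 * √V) * ‖w - h‖ ^ 2) ρ :=
    (integrable_const _).add ((integrable_norm_sub_sq hS h).const_mul _)
  calc ∫ w, f w ∂ρ ≤ ∫ w, (α + γ / 2 * √V + γ / (2 * √V) * ‖w - h‖ ^ 2) ∂ρ := by
        refine integral_mono_of_nonneg hf hi ?_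
        filter_upwards [hle] with w hw
        refine hw.trans ?_
        rw [norm_sub_rev h w]
        have : ‖w - h‖ ≤ √V / 2 + ‖w - h‖ ^ 2 / (2 * √V) := by
          rw [div_add_div _ _ two_ne_zero (by positivity), le_div_iff₀ (by positivity)]
          nlinarith [sq_nonneg (√V - ‖w - h‖)]
        have h2 := mul_le_mul_of_nonneg_left this hγ
        have h3 : γ * (√V / 2 + ‖w - h‖ ^ 2 / (2 * √V))
          = γ / 2 * √V + γ / (2 * √V) * ‖w - h‖ ^ 2 := by field_simp
        linarith
    _ = α + γ / 2 * √V + γ / (2 * √V) * V := by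
        rw [integral_add (integrable_const _) ((integrable_norm_sub_sq hS h).const_mul _),
          integral_const_mul, hVdef, taskVar]
        simp
    _ = _ := by
        have : γ / (2 * √V) * V = γ / 2 * √V := by
          rw [div_mul_eq_mul_div, div_eq_iff (by positivity)]
          linear_combination -γ * Real.mul_self_sqrt hV.le
        rw [this]
        ring

/-- The transfer regret of BIAS-OFUL with an arbitrary bias. -/
lemma IsTransferRun.transferRegret_le {Ω : Type*} {mΩ : MeasurableSpace Ω} {P : Measure Ω}
    [IsProbabilityMeasure P] {ℱ : EuclideanSpace ℝ (Fin d) → Filtration ℕ mΩ}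
    {D : EuclideanSpace ℝ (Fin d) → ℕ → Ω → Set (EuclideanSpace ℝ (Fin d))}
    {x xs : EuclideanSpace ℝ (Fin d) → ℕ → Ω → EuclideanSpace ℝ (Fin d)}
    {η : EuclideanSpace ℝ (Fin d) → ℕ → Ω → ℝ} (hd : 0 < d) (hT : 0 < T) (hR : 0 ≤ R) {S : ℝ}
    (hS : ∀ᵐ w ∂ρ, ‖w‖ ≤ S) (hV : 0 < taskVar ρ h)
    (hrun : IsTransferRun T R L (1 / (T * taskVar ρ h)) h ρ P ℱ D x xs η) :
    transferRegret T ρ P xs x ≤ transferBound (20 * max 1 R * max 1 L) T d L (taskVar ρ h) ∧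
      transferRegret T ρ P xs x ≤ transferBound (20 * max 1 R) T d (L ^ 2) (taskVar ρ h) := by
  have hL : 0 ≤ L := by
    obtain ⟨w, hw⟩ := hrun.bandit.exists
    exact hw.nonneg hT
  suffices hmain : transferRegret T ρ P xs x
      ≤ transferBound (20 * max 1 R) T d (L ^ 2) (taskVar ρ h) from
    ⟨hmain.trans (transferBound_sq_le hT (by positivity) hL hV.le), hmain⟩
  have : NeZero d := ⟨hd.ne'⟩
  have hT0 : (0 : ℝ) < T := by exact_mod_cast hT
  have hd0 : (0 : ℝ) < d := by exact_mod_cast hd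
  have hd1 : (1 : ℝ) ≤ d := by exact_mod_cast hd
  set V := taskVar ρ h with hVdef
  set lam := 1 / (T * V) with hlamdef
  have hlam : 0 < lam := by positivity
  set z := L ^ 2 * ((T : ℝ) ^ 2 * V / d) with hzdef
  have hz0 : 0 ≤ z := by positivity
  have hz : z = T * L ^ 2 / (lam * d) := by
    rw [hzdef, hlamdef]; field_simp
  have hsT : 0 < √(T : ℝ) := Real.sqrt_pos.2 hT0
  have hsV : 0 < √V := Real.sqrt_pos.2 hV
  have hslam : √lam = 1 / (√T * √V) := by
    rw [hlamdef, Real.sqrt_div zero_le_one, Real.sqrt_one, Real.sqrt_mul hT0.le]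
  have hf0 : 0 ≤ᵐ[ρ] fun w => ∫ ω, pseudoRegret T w (xs w) (x w) ω ∂P := by
    filter_upwards [hrun.bandit, hrun.optimal] with w hb ho
    exact integral_nonneg_of_ae (hb.pseudoRegret_nonneg ho)
  set q := √(d * Real.log (T + T * z)) with hq
  have hq0 : 0 ≤ q := Real.sqrt_nonneg _
  set Q := √(d * Real.log (1 + z)) with hQ
  have hQ0 : 0 ≤ Q := Real.sqrt_nonneg _
  set A := 1 + √T * q with hA
  have hA1 : 1 ≤ A := by rw [hA]; linarith [mul_nonneg hsT.le hq0]
  have hTA : √T ≤ 2 * A := sqrt_natCast_le hT hd hz0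
  set m := max 1 R with hm
  have hm1 : 1 ≤ m := le_max_left _ _
  have hRm : R ≤ m := le_max_right _ _
  have hs2 : √2 ≤ 3 / 2 := Real.sqrt_le_iff.2 ⟨by norm_num, by norm_num⟩
  have hs20 := Real.sqrt_nonneg 2
  have hℓ0 : 0 ≤ d * Real.log (1 + z) :=
    mul_nonneg hd0.le (Real.log_nonneg (by linarith))
  have hRq : R * (√2 * (√T * q)) ≤ 3 / 2 * (m * A) := by
    calc R * (√2 * (√T * q)) ≤ m * (3 / 2 * A) := by
          gcongr
          rw [hA]; linarith
      _ = _ := by ring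
  have hmA : A ≤ m * A := le_mul_of_one_le_left (by linarith) hm1
  rw [transferBound_eq, ← hzdef, ← hq, ← hQ, ← hA, transferRegret]
  -- Below the threshold the bound must vanish with the variance; above it `Q ≥ 1` absorbs additive
  -- constants.
  rcases le_total (d * Real.log (1 + z)) 1 with hsmall | hlarge
  · have hbound := integral_affine_norm_sub_le (h := h) hS hV hf0
      (α := T * (L / √lam * (R * (√2 * q) + 2 * R))) (γ := T * (L / √lam * (2 * √lam)))
      (by positivity) (by
        filter_upwards [hrun.bandit, hrun.policy, hrun.optimal] with w hb hp ho
        refine (hb.integral_pseudoRegret_le_of_small hlam hT hR hp ho hz hsmall).trans (le_of_eq ?_)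
        ring)
    refine hbound.trans ?_
    rw [← hVdef, hslam]
    -- The square of the left side is `d * z`. As `d ≥ 1`, `log (1 + z) ≤ 1`, so `1 + z ≤ 3` and `z
    -- ≤ 3 * log (1 + z)`.
    have hTL : T * L * √V ≤ 2 * Q := by
      have h1 : Real.log (1 + z) ≤ 1 := by
        nlinarith [Real.log_nonneg (by linarith : 1 ≤ 1 + z)]
      have h2 : 1 + z ≤ 3 := by
        have := (Real.log_le_iff_le_exp (by positivity)).1 h1
        linarith [Real.exp_one_lt_d9]
      have h3 := Real.one_sub_inv_le_log_of_pos (x := 1 + z) (by positivity)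
      have h4 : z ≤ 3 * Real.log (1 + z) := by
        have : z / 3 ≤ 1 - (1 + z)⁻¹ := by
          rw [le_sub_iff_add_le, ← le_sub_iff_add_le', inv_le_iff_one_le_mul₀ (by positivity)]
          nlinarith
        linarith
      refine le_of_sq_le_sq ?_ (by positivity)
      rw [mul_pow, mul_pow, Real.sq_sqrt hV.le, mul_pow, hQ, Real.sq_sqrt hℓ0]
      have h5 : (T : ℝ) ^ 2 * L ^ 2 * V = d * z := by rw [hzdef]; field_simp
      rw [h5]
      nlinarith [mul_le_mul_of_nonneg_left h4 hd0.le]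
    calc T * (L / (1 / (√T * √V)) * (R * (√2 * q) + 2 * R))
          + T * (L / (1 / (√T * √V)) * (2 * (1 / (√T * √V)))) * √V
        = T * L * √V * (R * (√2 * (√T * q)) + 2 * R * √T + 2) := by
          field_simp
      _ ≤ 2 * Q * (3 / 2 * (m * A) + 2 * m * (2 * A) + 2 * (m * A)) := by
          gcongr
          linarith
      _ = 15 * (m * A * Q) := by ring
      _ ≤ 20 * (m * A * Q) := by
          have : 0 ≤ m * A * Q := by positivity
          linarith
      _ = _ := by ring
  · have hbound := integral_affine_norm_sub_le (h := h) hS hV hf0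
      (α := 2 + 2 * (1 + R * (√2 * q)) * √(2 * T * (d * Real.log (1 + z))))
      (γ := 2 * √lam * √(2 * T * (d * Real.log (1 + z))))
      (by positivity) (by
        filter_upwards [hrun.bandit, hrun.policy, hrun.optimal] with w hb hp ho
        refine (hb.integral_pseudoRegret_le hlam hT hR hp ho hz).trans (le_of_eq ?_)
        ring)
    refine hbound.trans ?_
    rw [← hVdef, hslam, Real.sqrt_mul (by positivity), Real.sqrt_mul zero_le_two, ← hQ]
    have hQ1 : 1 ≤ Q := Real.one_le_sqrt.2 hlarge
    calc 2 + 2 * (1 + R * (√2 * q)) * (√2 * √T * Q)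
          + 2 * (1 / (√T * √V)) * (√2 * √T * Q) * √V
        = 2 * (1 * 1) + 2 * √2 * ((√T + R * (√2 * (√T * q)) + 1) * Q) := by
          field_simp
          ring
      _ ≤ 2 * (m * A * Q) + 2 * (3 / 2) * ((2 * (m * A) + 3 / 2 * (m * A) + m * A) * Q) := by
          have h1 : 1 ≤ m * A * Q := one_le_mul_of_one_le_of_one_le (hA1.trans hmA) hQ1
          have h2 : √T + R * (√2 * (√T * q)) + 1 ≤ 2 * (m * A) + 3 / 2 * (m * A) + m * A := by
            linarith
          have h3 : 2 * √2 ≤ 2 * (3 / 2) := by linarith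
          have h4 : 0 ≤ √T + R * (√2 * (√T * q)) + 1 := by positivity
          refine add_le_add (by linarith) ?_
          exact mul_le_mul h3 (mul_le_mul_of_nonneg_right h2 hQ0) (mul_nonneg h4 hQ0) (by norm_num)
      _ = 31 / 2 * (m * A * Q) := by ring
      _ ≤ 20 * (m * A * Q) := by
          have : 0 ≤ m * A * Q := by positivity
          linarith
      _ = _ := by ring

end Transfer

theorem mainTheorem6 :
    (∃ C : ℝ, 0 < C ∧
      ∀ (d T : ℕ) (_ : 0 < d) (_ : 0 < T) (R L S : ℝ) (_ : 0 ≤ R)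
        (ρ : Measure (EuclideanSpace ℝ (Fin d))) (_ : IsProbabilityMeasure ρ)
        (_ : ∀ᵐ w ∂ρ, ‖w‖ ≤ S)
        (Ω : Type*) (mΩ : MeasurableSpace Ω) (P : Measure Ω) (_ : IsProbabilityMeasure P)
        (ℱ : EuclideanSpace ℝ (Fin d) → Filtration ℕ mΩ)
        (D : EuclideanSpace ℝ (Fin d) → ℕ → Ω → Set (EuclideanSpace ℝ (Fin d)))
        (x xs : EuclideanSpace ℝ (Fin d) → ℕ → Ω → EuclideanSpace ℝ (Fin d))
        (η : EuclideanSpace ℝ (Fin d) → ℕ → Ω → ℝ),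
        -- independent task learning
        (0 < taskVar ρ 0 → 1 ≤ 1 / (T * taskVar ρ 0) →
          IsTransferRun T R L (1 / (T * taskVar ρ 0)) 0 ρ P ℱ D x xs η →
            transferRegret T ρ P xs x
                ≤ transferBound (C * max 1 R * max 1 L) T d L (taskVar ρ 0) ∧
              transferRegret T ρ P xs x
                ≤ transferBound (C * max 1 R) T d (L ^ 2) (taskVar ρ 0)) ∧
        -- the oracle
        (0 < taskVar ρ (meanTask ρ) → 1 ≤ 1 / (T * taskVar ρ (meanTask ρ)) →
          IsTransferRun T R L (1 / (T * taskVar ρ (meanTask ρ))) (meanTask ρ) ρ P ℱ D x xs η →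
            transferRegret T ρ P xs x
                ≤ transferBound (C * max 1 R * max 1 L) T d L (taskVar ρ (meanTask ρ)) ∧
              transferRegret T ρ P xs x
                ≤ transferBound (C * max 1 R) T d (L ^ 2) (taskVar ρ (meanTask ρ)))) ∧
    -- the bound vanishes with the variance
    (∀ (C L : ℝ) (d T : ℕ), 0 < d → 0 < T →
      Tendsto (fun V : ℝ => transferBound C T d L V) (𝓝[>] 0) (𝓝 0)) := by
  -- The two regimes give the constants 15 and `31 / 2`; 20 covers both.
  refine ⟨⟨20, by norm_num, ?_⟩, fun C L d T _ hT => tendsto_transferBound C L hT⟩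
  intro d T hd hT R L S hR ρ _ hS Ω mΩ P _ ℱ D x xs η
  exact ⟨fun hV _ hrun => hrun.transferRegret_le hd hT hR hS hV,
    fun hV _ hrun => hrun.transferRegret_le hd hT hR hS hV⟩
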